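/- **Setting.** Let $\Theta=\Theta_1\times\dots\times\Theta_D\subseteq\mathbb R^D$ with measurable $\Theta_i\subseteq\mathbb R$, equipped with the Euclidean norm. Let $\mathbb P(\Theta)$ be the set of probability measures on $\Theta$ that admit Lebesgue densities, let $\mathbb P_2(\Theta)\subseteq\mathbb P(\Theta)$ be those with finite second moment, and let $W_2$ be the 2-Wasserstein distance. For $q\in\mathbb P(\Theta)$ let $q_1,\dots,q_D$ be its one-dimensional marginals and $\Xi(q)=D_{\mathrm{KL}}(q\,\|\,q_1\otimes\dots\otimes q_D)$. For probability measures $m_1,\dots,m_D$ on $\mathbb R$ with product $m$, let $\mathcal C(m)$ be the set of $q\in\mathbb P(\Theta)$ with marginals $m_1,\dots,m_D$. Let $\pi=\pi_1\otimes\dots\otimes\pi_D\in\mathbb P(\Theta)$ be a prior and let $\ell:\Theta\to\mathbb R$ be a measurable log-likelihood (of fixed data) with $\int e^{\ell}\,d\pi<\infty$. Assume that the exact posterior $q_0^*\propto e^{\ell}\pi$ lies in $\mathbb P_2(\Theta)$. For $\lambda\in(0,\infty]$ let $\mathbb Q_\lambda$ be the set of minimizers over $\mathbb P_2(\Theta)$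 of $$q\mapsto D_{\mathrm{KL}}(q\,\|\,q_0^*)+\lambda\,\Xi(q),\qquad \infty\cdot 0=0 .$$ Thus $\mathbb Q_\infty$ is the set of mean-field variational posteriors. For each $\lambda\in(0,\infty)$ let $q_\lambda^*\in\mathbb Q_\lambda$, and let $m_\lambda^*$ be the product of the marginals of $q_\lambda^*$. *EOT coupling.* For $\lambda\in(0,\infty)$ and a product measure $m$, an EOT coupling of the marginals of $m$ with parameter $\lambda$ is a minimizer of $$q\mapsto \mathbb E_q[-\ell(\theta)]+(\lambda+1)\,D_{\mathrm{KL}}(q\,\|\,m)$$ over the $q\in\mathcal C(m)$ for which both terms are finite. *Assumptions on a product measure $\tilde m$ (the pseudomarginals).* - *Lipschitz cost:* there is a constant $L\ge 0$ such that for every $\lambda\in(0,\infty)$ there are measurable $\phi_i:\Theta_i\to\mathbb R$ for which, for all $q\in\mathcal C(m_\lambda^*)$ and $\tilde q\in\mathcal C(\tilde m)$, the function $g(\theta)=\ell(\theta)-\sum_{i=1}^D\phi_i(\theta_i)$ is integrable under $q$ and under $\tilde q$, and $\left|\int g\,dq-\int g\,d\tilde q\right|\le L\,W_2(q,\tilde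 q)$. - *Transportation cost inequality:* there is a constant $C\geq 0$ such that $W_2(q_1,q_2)\le C\,D_{\mathrm{KL}}(q_1\,\|\,q_2)^{1/4}$ for all $q_1,q_2\in\mathcal C(\tilde m)$. **Corollary.** 1. Assume that $D_{\mathrm{KL}}(m\,\|\,q_0^*)<\infty$ for some product probability measure $m$. Assume that every $q_\infty\in\mathbb Q_\infty$ satisfies $\ell\in L^1(q_\infty)$ and both assumptions above with $\tilde m=q_\infty$ (with constants that may depend on $q_\infty$). For $q_\infty\in\mathbb Q_\infty$ and $\lambda\in(0,\infty)$ let $q_\lambda^{(q_\infty)}$ be an EOT coupling of the marginals of $q_\infty$ with parameter $\lambda$. If the mean-field variational posterior is unique, $\mathbb Q_\infty=\{q_\infty^*\}$, then $$\lim_{\lambda\to\infty}W_2\big(q_\lambda^{(q_\infty^*)},\,q_\lambda^*\big)=0 .$$ In general (without uniqueness), $$\lim_{\lambda\to\infty}\ \inf_{q_\infty\in\mathbb Q_\infty}W_2\big(q_\lambda^{(q_\infty)},\,q_\lambda^*\big)=0 .$$ 2. Assume that $\ell\in L^1(q_0^*)$ and that both assumptions above hold with $\tilde m$ the product of the marginals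 of $q_0^*$. For $\lambda\in(0,\infty)$ let $q_\lambda^{(0)}$ be an EOT coupling of the marginals of $q_0^*$ with parameter $\lambda$. Then $$\lim_{\lambda\to0^+}W_2\big(q_\lambda^{(0)},\,q_\lambda^*\big)=0 .$$ -/

import Mathlib

open MeasureTheory Filter Topology InformationTheory
open scoped ENNReal NNReal

noncomputable section

/-- Squared Euclidean norm on `ℝ^D` (the type `Fin D → ℝ` itself carries the sup norm). -/
def euclSq {D : ℕ} (v : Fin D → ℝ) : ℝ := ∑ i, v i ^ 2

/-- Couplings of two measures on `ℝ^D`, i.e. transport plans on `ℝ^D × ℝ^D`. -/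
def transportPlans {D : ℕ} (μ ν : Measure (Fin D → ℝ)) :
    Set (Measure ((Fin D → ℝ) × (Fin D → ℝ))) :=
  {γ | γ.map Prod.fst = μ ∧ γ.map Prod.snd = ν}

/-- The 2-Wasserstein distance with respect to the Euclidean norm, with values in `[0, ∞]`. -/
def wasserstein2 {D : ℕ} (μ ν : Measure (Fin D → ℝ)) : ℝ≥0∞ :=
  (⨅ γ ∈ transportPlans μ ν, ∫⁻ z, ENNReal.ofReal (euclSq (z.1 - z.2)) ∂γ) ^ (1 / 2 : ℝ)

/-- `P(Θ)` for `Θ = Θ₁ × ⋯ × Θ_D`: probability measures concentrated on `Θ` that have a Lebesgue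
density. -/
def probMeasures {D : ℕ} (Θ : Fin D → Set ℝ) : Set (Measure (Fin D → ℝ)) :=
  {q | IsProbabilityMeasure q ∧ q ≪ volume ∧ q (Set.univ.pi Θ)ᶜ = 0}

/-- `P₂(Θ)`: the members of `P(Θ)` with finite second moment. -/
def probMeasures2 {D : ℕ} (Θ : Fin D → Set ℝ) : Set (Measure (Fin D → ℝ)) :=
  {q | q ∈ probMeasures Θ ∧ ∫⁻ θ, ENNReal.ofReal (euclSq θ) ∂q < ∞}

/-- The one-dimensional marginals of a measure on `ℝ^D`. -/
def marginals {D : ℕ} (q : Measure (Fin D → ℝ)) : Fin D → Measure ℝ :=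
  fun i => q.map (fun θ => θ i)

/-- `C(m₁, …, m_D)`: the members of `P(Θ)` with one-dimensional marginals `m₁, …, m_D`. -/
def couplings {D : ℕ} (Θ : Fin D → Set ℝ) (m : Fin D → Measure ℝ) :
    Set (Measure (Fin D → ℝ)) :=
  {q | q ∈ probMeasures Θ ∧ marginals q = m}

/-- The expressivity `Ξ(q) = KL(q ‖ q₁ ⊗ ⋯ ⊗ q_D)`. -/
def expressivity {D : ℕ} (q : Measure (Fin D → ℝ)) : ℝ≥0∞ :=
  klDiv q (Measure.pi (marginals q))

/-- The exact posterior, proportional to `exp(ℓ(θ)) π₁(dθ₁) ⋯ π_D(dθ_D)`; here `ℓ` is the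
log-likelihood of the (fixed) data. -/
def posterior {D : ℕ} (prior : Fin D → Measure ℝ) (ℓ : (Fin D → ℝ) → ℝ) :
    Measure (Fin D → ℝ) :=
  (Measure.pi prior).tilted ℓ

/-- `KL(q ‖ q₀) + λ Ξ(q)` for `λ ∈ [0, ∞]`. In `[0, ∞]` one has `∞ * 0 = 0`, so for `λ = ∞` this is
`KL(q ‖ q₀)` on product measures and `∞` elsewhere. -/
def xiObjective {D : ℕ} (q₀ : Measure (Fin D → ℝ)) (lam : ℝ≥0∞) (q : Measure (Fin D → ℝ)) :
    ℝ≥0∞ :=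
  klDiv q q₀ + lam * expressivity q

/-- The set of `Ξ`-variational posteriors with parameter `λ ∈ [0, ∞]`: all minimizers of the
objective over `P₂(Θ)`. For `λ = ∞` these are the mean-field variational posteriors. -/
def xiPosteriors {D : ℕ} (Θ : Fin D → Set ℝ) (q₀ : Measure (Fin D → ℝ)) (lam : ℝ≥0∞) :
    Set (Measure (Fin D → ℝ)) :=
  {q | q ∈ probMeasures2 Θ ∧ ∀ q' ∈ probMeasures2 Θ, xiObjective q₀ lam q ≤ xiObjective q₀ lam q'}

/-- The couplings of `m` at which both terms of the entropic optimal transport objective are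
finite. -/
def eotFeasible {D : ℕ} (Θ : Fin D → Set ℝ) (ℓ : (Fin D → ℝ) → ℝ) (m : Fin D → Measure ℝ) :
    Set (Measure (Fin D → ℝ)) :=
  {q | q ∈ couplings Θ m ∧ Integrable ℓ q ∧ klDiv q (Measure.pi m) ≠ ∞}

/-- The entropic optimal transport objective `E_q[-ℓ] + (λ + 1) KL(q ‖ m₁ ⊗ ⋯ ⊗ m_D)`. -/
def eotObjective {D : ℕ} (ℓ : (Fin D → ℝ) → ℝ) (lam : ℝ) (m : Fin D → Measure ℝ)
    (q : Measure (Fin D → ℝ)) : ℝ :=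
  ∫ θ, -ℓ θ ∂q + (lam + 1) * (klDiv q (Measure.pi m)).toReal

/-- `q` is an optimizer of the entropic optimal transport problem with marginals `m`. -/
def IsEOTOptimizer {D : ℕ} (Θ : Fin D → Set ℝ) (ℓ : (Fin D → ℝ) → ℝ) (lam : ℝ)
    (m : Fin D → Measure ℝ) (q : Measure (Fin D → ℝ)) : Prop :=
  q ∈ eotFeasible Θ ℓ m ∧
    ∀ q' ∈ eotFeasible Θ ℓ m, eotObjective ℓ lam m q ≤ eotObjective ℓ lam m q'

/-- Lipschitz cost with constant `L` between couplings of `m` and couplings of `m'`: after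
subtracting suitable functions of the single coordinates, integrals of `ℓ` against such couplings
exist and differ by at most `L` times the Wasserstein distance. -/
def LipschitzCost {D : ℕ} (Θ : Fin D → Set ℝ) (ℓ : (Fin D → ℝ) → ℝ) (L : ℝ≥0)
    (m m' : Fin D → Measure ℝ) : Prop :=
  ∃ φ : Fin D → ℝ → ℝ, (∀ i, Measurable (φ i)) ∧
    ∀ q ∈ couplings Θ m, ∀ q' ∈ couplings Θ m',
      Integrable (fun θ => ℓ θ - ∑ i, φ i (θ i)) q ∧
      Integrable (fun θ => ℓ θ - ∑ i, φ i (θ i)) q' ∧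
      ENNReal.ofReal
          |∫ θ, (ℓ θ - ∑ i, φ i (θ i)) ∂q - ∫ θ, (ℓ θ - ∑ i, φ i (θ i)) ∂q'| ≤
        L * wasserstein2 q q'

/-- Transportation cost inequality with constant `C` between couplings of `m`:
`W₂(q₁, q₂) ≤ C KL(q₁ ‖ q₂)^(1/4)`. -/
def TransportInequality {D : ℕ} (Θ : Fin D → Set ℝ) (C : ℝ≥0) (m : Fin D → Measure ℝ) : Prop :=
  ∀ q₁ ∈ couplings Θ m, ∀ q₂ ∈ couplings Θ m,
    wasserstein2 q₁ q₂ ≤ C * klDiv q₁ q₂ ^ (1 / 4 : ℝ)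

end

/-!
For finite `λ`, a `Ξ`-variational posterior `q` also minimizes `KL(· ‖ q₀) + λ KL(· ‖ m)`, where
`q₀` is the exact posterior and `m` the product of the marginals of `q`. Hence `q` is the
normalized geometric mean of `q₀` and `m` with weights `1` and `λ` (`xiPosterior_eq_withDensity`).
This form has two consequences.

*Compactness.* By the weighted arithmetic-geometric mean inequality, the marginals of `q` are
dominated by `exp F` times those of `q₀`, where `F` is the value of the objective, so all `q` with
bounded `F` lie below one finite measure with a finite second moment
(`xiPosterior_le_dominating`). Under such a domination setwise limits exist along ultrafilters
(`exists_setwise_limit`), the divergence is lower semicontinuous, and setwise convergence implies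
`W₂`-convergence (`tendsto_transportCost`). As `λ → ∞` the expressivity tends to `0`, so limits
are product measures, and they are mean-field posteriors (`exists_meanField_limit`). As `λ → 0`
the divergence from `q₀` tends to `0`, so the limit is `q₀` (`tendsto_transportCost_posterior`).

*Optimality.* The log-density of `q` with respect to `m` is `ℓ / (1 + λ)` up to a separable
function, so `q` solves the entropic transport problem between its own marginals
(`xiPosterior_optimal`).

It remains to compare, for the same `λ`, the solutions of two entropic transport problems with
nearby marginals. Any plan between laws with these marginals transports a coupling of the one
family to a coupling of the other, its shadow, without increase of the divergence from the product
measure (`exists_shadow`). By the Lipschitz cost assumption the shadow of `q` is then nearly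
optimal; by the strong convexity of the divergence (`klDiv_midpoint`, `eot_excess`) it has small
divergence from its midpoint with the optimizer, as has the optimizer; and by the transportation
cost inequality both are close to that midpoint. The resulting bound is uniform in `λ`
(`transportCost_eot_xiPosterior_le`).

The Lipschitz cost assumption concerns `ℓ` up to a separable function `∑ φ i`, whose summands need
not be integrable a priori. Their integrability follows from a bound under the product measure
(`integrable_of_integrable_sum`).
-/

/-! ### Quadratic transport cost -/

/-- The optimal quadratic transport cost, i.e. the square of `wasserstein2`. -/
noncomputable def transportCost {D : ℕ} (μ ν : Measure (Fin D → ℝ)) : ℝ≥0∞ :=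
  ⨅ γ ∈ transportPlans μ ν, ∫⁻ z, ENNReal.ofReal (euclSq (z.1 - z.2)) ∂γ

lemma wasserstein2_eq {D : ℕ} (μ ν : Measure (Fin D → ℝ)) :
    wasserstein2 μ ν = transportCost μ ν ^ (1 / 2 : ℝ) := rfl

lemma transportCost_eq_sq {D : ℕ} (μ ν : Measure (Fin D → ℝ)) :
    transportCost μ ν = wasserstein2 μ ν ^ 2 := by
  rw [wasserstein2_eq, ← ENNReal.rpow_natCast, ← ENNReal.rpow_mul]
  norm_num

lemma euclSq_nonneg {D : ℕ} (v : Fin D → ℝ) : 0 ≤ euclSq v :=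
  Finset.sum_nonneg fun _ _ => sq_nonneg _

@[fun_prop]
lemma continuous_euclSq {D : ℕ} : Continuous (euclSq : (Fin D → ℝ) → ℝ) := by
  unfold euclSq; fun_prop

@[fun_prop]
lemma measurable_euclSq {D : ℕ} : Measurable (euclSq : (Fin D → ℝ) → ℝ) :=
  continuous_euclSq.measurable

lemma euclSq_sub_comm {D : ℕ} (x y : Fin D → ℝ) : euclSq (x - y) = euclSq (y - x) := by
  unfold euclSq
  exact Finset.sum_congr rfl fun i _ => by simp only [Pi.sub_apply]; ring

lemma euclSq_sub_le {D : ℕ} (x y z : Fin D → ℝ) :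
    euclSq (x - z) ≤ 2 * euclSq (x - y) + 2 * euclSq (y - z) := by
  unfold euclSq
  rw [Finset.mul_sum, Finset.mul_sum, ← Finset.sum_add_distrib]
  refine Finset.sum_le_sum fun i _ => ?_
  simp only [Pi.sub_apply]
  nlinarith [sq_nonneg (x i - y i - (y i - z i))]

lemma ofReal_euclSq_sub_le {D : ℕ} (x y z : Fin D → ℝ) :
    ENNReal.ofReal (euclSq (x - z)) ≤
      2 * ENNReal.ofReal (euclSq (x - y)) + 2 * ENNReal.ofReal (euclSq (y - z)) := by
  refine (ENNReal.ofReal_le_ofReal (euclSq_sub_le x y z)).trans_eq ?_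
  rw [ENNReal.ofReal_add (by linarith [euclSq_nonneg (x - y)])
      (by linarith [euclSq_nonneg (y - z)]),
    ENNReal.ofReal_mul (by norm_num), ENNReal.ofReal_mul (by norm_num)]
  norm_num

lemma euclSq_le_norm {D : ℕ} (v : Fin D → ℝ) : euclSq v ≤ D * ‖v‖ ^ 2 := by
  unfold euclSq
  calc ∑ i, v i ^ 2 ≤ ∑ _i : Fin D, ‖v‖ ^ 2 := by
        refine Finset.sum_le_sum fun i _ => ?_
        have := norm_le_pi_norm v i
        rw [← sq_abs, ← Real.norm_eq_abs]
        gcongr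
    _ = D * ‖v‖ ^ 2 := by simp

lemma norm_sq_le_euclSq {D : ℕ} (v : Fin D → ℝ) : ‖v‖ ^ 2 ≤ euclSq v := by
  have h : ‖v‖ ≤ √(euclSq v) := by
    refine (pi_norm_le_iff_of_nonneg (Real.sqrt_nonneg _)).2 fun i => ?_
    rw [Real.norm_eq_abs]
    refine Real.abs_le_sqrt ?_
    exact Finset.single_le_sum (f := fun i => v i ^ 2) (fun _ _ => sq_nonneg _) (Finset.mem_univ i)
  calc ‖v‖ ^ 2 ≤ √(euclSq v) ^ 2 := by gcongr
    _ = euclSq v := Real.sq_sqrt (euclSq_nonneg v)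

lemma transportCost_le {D : ℕ} {μ ν : Measure (Fin D → ℝ)}
    {γ : Measure ((Fin D → ℝ) × (Fin D → ℝ))} (hγ : γ ∈ transportPlans μ ν) :
    transportCost μ ν ≤ ∫⁻ z, ENNReal.ofReal (euclSq (z.1 - z.2)) ∂γ :=
  iInf₂_le γ hγ

lemma exists_plan_lt {D : ℕ} {μ ν : Measure (Fin D → ℝ)} {c : ℝ≥0∞} (h : transportCost μ ν < c) :
    ∃ γ ∈ transportPlans μ ν, ∫⁻ z, ENNReal.ofReal (euclSq (z.1 - z.2)) ∂γ < c := by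
  simpa only [transportCost, iInf_lt_iff, exists_prop] using h

lemma transportCost_comm {D : ℕ} (μ ν : Measure (Fin D → ℝ)) :
    transportCost μ ν = transportCost ν μ := by
  suffices h : ∀ μ ν : Measure (Fin D → ℝ), transportCost μ ν ≤ transportCost ν μ from
    le_antisymm (h μ ν) (h ν μ)
  intro μ ν
  refine le_iInf₂ fun γ hγ => ?_
  have hm : γ.map Prod.swap ∈ transportPlans μ ν := by
    refine ⟨?_, ?_⟩
    · rw [Measure.map_map measurable_fst measurable_swap]; exact hγ.2
    · rw [Measure.map_map measurable_snd measurable_swap]; exact hγ.1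
  refine (transportCost_le hm).trans_eq ?_
  rw [lintegral_map (by fun_prop) measurable_swap]
  refine lintegral_congr fun z => ?_
  rw [Prod.fst_swap, Prod.snd_swap, euclSq_sub_comm]

/-- Gluing: two plans with a common middle marginal are the two-dimensional marginals of a measure
on triples, obtained by disintegrating the second plan along its first coordinate. -/
lemma exists_gluing {Ω : Type*} [MeasurableSpace Ω] [StandardBorelSpace Ω] [Nonempty Ω]
    {γ₁ γ₂ : Measure (Ω × Ω)} [IsProbabilityMeasure γ₁] [IsProbabilityMeasure γ₂]
    (h : γ₁.map Prod.snd = γ₂.map Prod.fst) :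
    ∃ Γ : Measure ((Ω × Ω) × Ω), Γ.map Prod.fst = γ₁ ∧ Γ.map (fun w => (w.1.2, w.2)) = γ₂ := by
  let K : ProbabilityTheory.Kernel (Ω × Ω) Ω :=
    ProbabilityTheory.Kernel.comap γ₂.condKernel (Prod.snd : Ω × Ω → Ω)
      measurable_snd
  refine ⟨γ₁.compProd K, Measure.fst_compProd _ _, ?_⟩
  have h2 : γ₂ = (γ₁.map Prod.snd).compProd γ₂.condKernel := by
    rw [h]; exact (Measure.disintegrate γ₂ γ₂.condKernel).symm
  conv_rhs => rw [h2]
  have hm : Measurable (fun w : (Ω × Ω) × Ω => (w.1.2, w.2)) := by fun_prop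
  ext s hs
  rw [Measure.map_apply hm hs, Measure.compProd_apply (hm hs),
    Measure.compProd_apply hs, lintegral_map]
  · rfl
  · exact ProbabilityTheory.Kernel.measurable_kernel_prodMk_left hs
  · exact measurable_snd

/-- The quasi-triangle inequality, with the factor from `(s + t)² ≤ 2 s² + 2 t²`. It replaces the
triangle inequality of the Wasserstein distance, as only limits are at stake. -/
lemma transportCost_triangle {D : ℕ} (μ ν ρ : Measure (Fin D → ℝ)) [IsProbabilityMeasure ν] :
    transportCost μ ρ ≤ 2 * transportCost μ ν + 2 * transportCost ν ρ := by
  rw [transportCost, transportCost, transportCost, ENNReal.mul_iInf_of_ne (by simp) (by simp),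
    ENNReal.mul_iInf_of_ne (by simp) (by simp)]
  simp_rw [ENNReal.mul_iInf_of_ne (a := 2) (by simp) (by simp)]
  simp_rw [ENNReal.iInf_add, ENNReal.add_iInf]
  refine le_iInf₂ fun γ₁ h₁ => le_iInf₂ fun γ₂ h₂ => ?_
  have : IsProbabilityMeasure γ₁ := by
    have : IsProbabilityMeasure (γ₁.map Prod.snd) := by rw [h₁.2]; infer_instance
    exact Measure.isProbabilityMeasure_of_map Prod.snd
  have : IsProbabilityMeasure γ₂ := by
    have : IsProbabilityMeasure (γ₂.map Prod.fst) := by rw [h₂.1]; infer_instance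
    exact Measure.isProbabilityMeasure_of_map Prod.fst
  obtain ⟨Γ, hΓ₁, hΓ₂⟩ := exists_gluing (γ₁ := γ₁) (γ₂ := γ₂) (h₁.2.trans h₂.1.symm)
  have hmem : Γ.map (fun w => (w.1.1, w.2)) ∈ transportPlans μ ρ := by
    refine ⟨?_, ?_⟩
    · rw [Measure.map_map (by fun_prop) (by fun_prop), ← h₁.1, ← hΓ₁,
        Measure.map_map (by fun_prop) (by fun_prop)]
      rfl
    · rw [Measure.map_map (by fun_prop) (by fun_prop), ← h₂.2, ← hΓ₂,
        Measure.map_map (by fun_prop) (by fun_prop)]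
      rfl
  refine (iInf₂_le _ hmem).trans ?_
  rw [← hΓ₁, ← hΓ₂, lintegral_map (by fun_prop) (by fun_prop),
    lintegral_map (by fun_prop) (by fun_prop), lintegral_map (by fun_prop) (by fun_prop),
    ← lintegral_const_mul _ (by fun_prop), ← lintegral_const_mul _ (by fun_prop),
    ← lintegral_add_left (by fun_prop)]
  exact lintegral_mono fun w => ofReal_euclSq_sub_le _ _ _

lemma transportCost_map_le {D : ℕ} (μ : Measure (Fin D → ℝ)) {d : (Fin D → ℝ) → (Fin D → ℝ)}
    (hd : Measurable d) :
    transportCost μ (μ.map d) ≤ ∫⁻ x, ENNReal.ofReal (euclSq (x - d x)) ∂μ := by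
  have hm : Measurable (fun x => (x, d x)) := by fun_prop
  have hmem : μ.map (fun x => (x, d x)) ∈ transportPlans μ (μ.map d) := by
    refine ⟨?_, ?_⟩
    · rw [Measure.map_map (by fun_prop) hm]; exact Measure.map_id
    · rw [Measure.map_map (by fun_prop) hm]; rfl
  refine (transportCost_le hmem).trans_eq ?_
  rw [lintegral_map (by fun_prop) hm]

/-- If `ν' ≥ (1 - δ) ν` and both laws live on a set of diameter at most `√R`, then all but a mass
`δ` of `ν` can stay in place. -/
lemma transportCost_le_of_le {D : ℕ} {ν ν' : Measure (Fin D → ℝ)} [IsProbabilityMeasure ν]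
    [IsProbabilityMeasure ν'] {δ : ℝ≥0∞} (hδ : δ ≤ 1) (hle : (1 - δ) • ν ≤ ν') {R : ℝ≥0∞}
    {s : Set (Fin D → ℝ)} (hν : ∀ᵐ x ∂ν, x ∈ s) (hν' : ∀ᵐ x ∂ν', x ∈ s)
    (hR : ∀ x ∈ s, ∀ y ∈ s, ENNReal.ofReal (euclSq (x - y)) ≤ R) :
    transportCost ν ν' ≤ δ * R := by
  have hfin : IsFiniteMeasure ((1 - δ) • ν) := isFiniteMeasure_of_le ν' hle
  set η := ν' - (1 - δ) • ν with hη
  have hsum : η + (1 - δ) • ν = ν' := Measure.sub_add_cancel_of_le hle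
  have hηle : η ≤ ν' := Measure.sub_le
  have : IsFiniteMeasure η := isFiniteMeasure_of_le ν' hηle
  have hηu : η Set.univ = δ := by
    have h1 : η Set.univ + (1 - δ) = 1 := by
      have := congrArg (fun m => m Set.univ) hsum
      simpa using this
    have h2 : δ + (1 - δ) = 1 := add_tsub_cancel_of_le hδ
    exact (ENNReal.add_left_inj (ne_top_of_le_ne_top ENNReal.one_ne_top tsub_le_self)).1
      (h1.trans h2.symm)
  have hdiag : Measurable (fun x : Fin D → ℝ => (x, x)) := by fun_prop
  -- the part `(1 - δ) ν` stays in place, the excess `η` of `ν'` is filled from a copy of `ν`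
  have hmem : (1 - δ) • ν.map (fun x => (x, x)) + ν.prod η ∈ transportPlans ν ν' := by
    refine ⟨?_, ?_⟩
    · rw [Measure.map_add _ _ measurable_fst, Measure.map_smul,
        Measure.map_map measurable_fst hdiag]
      have : (Prod.fst ∘ fun x : Fin D → ℝ => (x, x)) = id := rfl
      rw [this, Measure.map_id, Measure.map_fst_prod, hηu, ← add_smul, tsub_add_cancel_of_le hδ,
        one_smul]
    · rw [Measure.map_add _ _ measurable_snd, Measure.map_smul,
        Measure.map_map measurable_snd hdiag]
      have : (Prod.snd ∘ fun x : Fin D → ℝ => (x, x)) = id := rfl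
      rw [this, Measure.map_id, Measure.map_snd_prod, measure_univ, one_smul, add_comm, hsum]
  refine (transportCost_le hmem).trans ?_
  rw [lintegral_add_measure, lintegral_smul_measure, lintegral_map (by fun_prop) hdiag]
  have h0 : ∀ x : Fin D → ℝ, euclSq (x - x) = 0 := fun x => by simp [euclSq]
  simp only [h0, ENNReal.ofReal_zero, lintegral_zero, smul_zero, zero_add]
  calc ∫⁻ z, ENNReal.ofReal (euclSq (z.1 - z.2)) ∂(ν.prod η) ≤ ∫⁻ _z, R ∂(ν.prod η) := by
        refine lintegral_mono_ae ?_
        have hη' : ∀ᵐ x ∂η, x ∈ s := (Measure.absolutelyContinuous_of_le hηle).ae_le hν'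
        have e1 : ∀ᵐ z ∂(ν.prod η), z.1 ∈ s := Measure.quasiMeasurePreserving_fst.ae hν
        have e2 : ∀ᵐ z ∂(ν.prod η), z.2 ∈ s := Measure.quasiMeasurePreserving_snd.ae hη'
        filter_upwards [e1, e2] with z h1 h2 using hR _ h1 _ h2
    _ = δ * R := by
        rw [lintegral_const, ← Set.univ_prod_univ, Measure.prod_prod, measure_univ, hηu, one_mul,
          mul_comm]

lemma memLp_id_of_lintegral_euclSq {D : ℕ} {κ : Measure (Fin D → ℝ)}
    (h : ∫⁻ x, ENNReal.ofReal (euclSq x) ∂κ < ∞) : MemLp (id : (Fin D → ℝ) → (Fin D → ℝ)) 2 κ := by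
  refine ⟨by fun_prop, ?_⟩
  rw [eLpNorm_lt_top_iff_lintegral_rpow_enorm_lt_top (by norm_num) (by norm_num)]
  refine lt_of_le_of_lt (lintegral_mono fun x => ?_) h
  simp only [id, ENNReal.toReal_ofNat, ENNReal.rpow_ofNat]
  rw [← ofReal_norm, ← ENNReal.ofReal_pow (norm_nonneg _)]
  exact ENNReal.ofReal_le_ofReal (norm_sq_le_euclSq x)

/-- Simple functions are dense in `L²(κ)`; here stated for the identity and the Euclidean norm. -/
lemma exists_simpleFunc_lintegral_euclSq_sub_le {D : ℕ} {κ : Measure (Fin D → ℝ)}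
    (h : ∫⁻ x, ENNReal.ofReal (euclSq x) ∂κ < ∞) {ε : ℝ≥0∞} (hε : ε ≠ 0) :
    ∃ d : SimpleFunc (Fin D → ℝ) (Fin D → ℝ),
      ∫⁻ x, ENNReal.ofReal (euclSq (x - d x)) ∂κ ≤ ε := by
  have hε' : (ε / (D + 1)) ^ (1 / 2 : ℝ) ≠ 0 := by
    have : ε / (D + 1) ≠ 0 := ENNReal.div_ne_zero.2 ⟨hε, by simp⟩
    simp [this]
  obtain ⟨d, hd, -⟩ := (memLp_id_of_lintegral_euclSq h).exists_simpleFunc_eLpNorm_sub_lt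
    (by norm_num) hε'
  refine ⟨d, ?_⟩
  rw [eLpNorm_eq_lintegral_rpow_enorm_toReal (by norm_num) (by norm_num)] at hd
  simp only [ENNReal.toReal_ofNat, ENNReal.rpow_ofNat] at hd
  rw [ENNReal.rpow_lt_rpow_iff (by norm_num)] at hd
  calc ∫⁻ x, ENNReal.ofReal (euclSq (x - d x)) ∂κ
      ≤ ∫⁻ x, (D + 1) * ‖((id : (Fin D → ℝ) → (Fin D → ℝ)) - ⇑d) x‖ₑ ^ 2 ∂κ := by
        refine lintegral_mono fun x => ?_
        refine (ENNReal.ofReal_le_ofReal (euclSq_le_norm _)).trans ?_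
        rw [ENNReal.ofReal_mul (by positivity), ENNReal.ofReal_pow (norm_nonneg _),
          ofReal_norm, ENNReal.ofReal_natCast]
        gcongr
        · exact le_self_add
        · rfl
    _ = (D + 1) * ∫⁻ x, ‖((id : (Fin D → ℝ) → (Fin D → ℝ)) - ⇑d) x‖ₑ ^ 2 ∂κ := by
        rw [lintegral_const_mul' _ _ (by simp)]
    _ ≤ (D + 1) * (ε / (D + 1)) := by gcongr
    _ ≤ ε := ENNReal.mul_div_le

/-- Setwise convergence of laws dominated by one finite measure with a finite second moment implies
convergence in the Wasserstein distance: a simple function close to the identity in `L²(κ)` moves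
all these laws to a common finite set, on which setwise convergence allows almost all mass to stay in
place. -/
lemma tendsto_transportCost {D : ℕ} {ι : Type*} {l : Filter ι} {μ : ι → Measure (Fin D → ℝ)}
    {ν κ : Measure (Fin D → ℝ)} [IsProbabilityMeasure ν]
    (hκ : ∫⁻ x, ENNReal.ofReal (euclSq x) ∂κ < ∞)
    (hμ : ∀ᶠ i in l, IsProbabilityMeasure (μ i)) (hμκ : ∀ᶠ i in l, μ i ≤ κ) (hν : ν ≤ κ)
    (hset : ∀ A, MeasurableSet A → Tendsto (fun i => μ i A) l (𝓝 (ν A))) :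
    Tendsto (fun i => transportCost ν (μ i)) l (𝓝 0) := by
  rw [ENNReal.tendsto_nhds_zero]
  intro ε hε
  obtain ⟨d, hd⟩ := exists_simpleFunc_lintegral_euclSq_sub_le hκ (ε := ε / 12)
    (by simp [hε.ne'])
  have hdm : Measurable d := d.measurable
  let S : Finset (Fin D → ℝ) := d.range
  let R : ℝ≥0∞ := ∑ x ∈ S, ∑ y ∈ S, ENNReal.ofReal (euclSq (x - y))
  have hRtop : R ≠ ∞ := by simp [R]
  have hR : ∀ x ∈ (S : Set (Fin D → ℝ)), ∀ y ∈ (S : Set (Fin D → ℝ)),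
      ENNReal.ofReal (euclSq (x - y)) ≤ R := fun x hx y hy =>
    (Finset.single_le_sum (f := fun y => ENNReal.ofReal (euclSq (x - y)))
      (fun _ _ => zero_le) hy).trans
      (Finset.single_le_sum (f := fun x => ∑ y ∈ S, ENNReal.ofReal (euclSq (x - y)))
      (fun _ _ => zero_le) hx)
  let δ : ℝ≥0∞ := min 1 (ε / 8 / (R + 1))
  have hδ0 : δ ≠ 0 := by
    have : ε / 8 / (R + 1) ≠ 0 :=
      ENNReal.div_ne_zero.2 ⟨by simp [hε.ne'], by simp [hRtop]⟩
    simp only [δ, ne_eq]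
    intro h
    rcases min_choice 1 (ε / 8 / (R + 1)) with h' | h'
    · rw [h'] at h; exact one_ne_zero h
    · rw [h'] at h; exact this h
  have hδ1 : δ ≤ 1 := min_le_left _ _
  have hδR : δ * R ≤ ε / 8 := by
    calc δ * R ≤ ε / 8 / (R + 1) * (R + 1) := by
          gcongr
          · exact min_le_right _ _
          · exact le_self_add
      _ = ε / 8 := ENNReal.div_mul_cancel (by simp) (by simp [hRtop])
  -- a finite-valued law is eventually dominated from below, point by point
  have hpt : ∀ s ∈ S, ∀ᶠ i in l, (1 - δ) * ν (d ⁻¹' {s}) ≤ μ i (d ⁻¹' {s}) := by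
    intro s _
    by_cases h0 : ν (d ⁻¹' {s}) = 0
    · simp [h0]
    · have hlt : (1 - δ) * ν (d ⁻¹' {s}) < ν (d ⁻¹' {s}) := by
        conv_rhs => rw [← one_mul (ν (d ⁻¹' {s}))]
        refine ENNReal.mul_lt_mul_left h0 (measure_ne_top _ _) ?_
        exact ENNReal.sub_lt_self ENNReal.one_ne_top one_ne_zero hδ0
      exact ((hset _ (d.measurableSet_fiber s)).eventually_const_lt hlt).mono fun i h => h.le
  have hall := (Finset.eventually_all S).2 hpt
  filter_upwards [hall, hμ, hμκ] with i hi hprob hle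
  have hprob1 : IsProbabilityMeasure (ν.map d) := Measure.isProbabilityMeasure_map hdm.aemeasurable
  have hprob2 : IsProbabilityMeasure ((μ i).map d) :=
    Measure.isProbabilityMeasure_map hdm.aemeasurable
  -- the pointwise bounds add up to a bound between the two finitely supported laws
  have hdom : (1 - δ) • ν.map d ≤ (μ i).map d := by
    classical
    refine Measure.le_iff.2 fun A hA => ?_
    have hpre : d ⁻¹' A = d ⁻¹' ((S.filter (· ∈ A) : Finset _) : Set (Fin D → ℝ)) := by
      ext x; simp [S]
    rw [Measure.smul_apply, Measure.map_apply hdm hA, Measure.map_apply hdm hA, hpre,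
      ← sum_measure_preimage_singleton _ fun y _ => d.measurableSet_fiber y,
      ← sum_measure_preimage_singleton _ fun y _ => d.measurableSet_fiber y, smul_eq_mul,
      Finset.mul_sum]
    exact Finset.sum_le_sum fun s hs => hi s (Finset.mem_filter.1 hs).1
  have hsupp : ∀ ρ : Measure (Fin D → ℝ), ∀ᵐ x ∂(ρ.map d), x ∈ (S : Set (Fin D → ℝ)) := by
    intro ρ
    refine (ae_map_iff hdm.aemeasurable S.measurableSet).2 (ae_of_all _ fun x => ?_)
    exact d.mem_range_self x
  have hmid := transportCost_le_of_le hδ1 hdom (hsupp ν) (hsupp (μ i)) hR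
  have hmove : ∀ ρ ≤ κ, transportCost ρ (ρ.map d) ≤ ε / 12 := fun ρ hρ =>
    (transportCost_map_le ρ hdm).trans ((lintegral_mono' hρ le_rfl).trans hd)
  calc transportCost ν (μ i)
      ≤ 2 * transportCost ν (ν.map d) + 2 * transportCost (ν.map d) (μ i) :=
        transportCost_triangle _ _ _
    _ ≤ 2 * transportCost ν (ν.map d) + 2 * (2 * transportCost (ν.map d) ((μ i).map d)
          + 2 * transportCost ((μ i).map d) (μ i)) := by
        gcongr; exact transportCost_triangle _ _ _
    _ ≤ 2 * (ε / 12) + 2 * (2 * (ε / 8) + 2 * (ε / 12)) := by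
        rw [transportCost_comm ((μ i).map d)]
        gcongr
        · exact hmove _ hν
        · exact hmid.trans hδR
        · exact hmove _ hle
    _ = ε * (2 * 12⁻¹ + 2 * (2 * 8⁻¹ + 2 * 12⁻¹)) := by
        simp only [div_eq_mul_inv]; ring
    _ = ε := by
        have : (2 * 12⁻¹ + 2 * (2 * 8⁻¹ + 2 * 12⁻¹) : ℝ≥0∞) = 1 := by
          rw [← ENNReal.toReal_eq_toReal_iff' (by finiteness) (by simp)]
          rw [ENNReal.toReal_add (by finiteness) (by finiteness)]
          simp only [ENNReal.toReal_mul]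
          rw [ENNReal.toReal_add (by finiteness) (by finiteness)]
          simp only [ENNReal.toReal_mul, ENNReal.toReal_inv, ENNReal.toReal_ofNat,
            ENNReal.toReal_one]
          norm_num
        rw [this, mul_one]

/-! ### Kullback–Leibler divergence -/

/-- Young's inequality for the conjugate pair `y ↦ y log y - y + 1` and `h ↦ exp h - 1`. -/
lemma mul_le_klFun_add_exp {y : ℝ} (hy : 0 ≤ y) (h : ℝ) : y * h ≤ klFun y + (Real.exp h - 1) := by
  rw [klFun_apply]
  rcases hy.eq_or_lt with rfl | hy
  · simp; positivity
  · have h1 := Real.add_one_le_exp (h - Real.log y)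
    have h2 : Real.exp h = y * Real.exp (h - Real.log y) := by
      rw [Real.exp_sub, Real.exp_log hy]; field_simp
    nlinarith

lemma klFun_le_sq {y : ℝ} (hy : 0 ≤ y) : klFun y ≤ (y - 1) ^ 2 := by
  rw [klFun_apply]
  rcases hy.eq_or_lt with rfl | hy
  · simp
  · nlinarith [Real.log_le_sub_one_of_pos hy]

/-- The Donsker–Varadhan inequality, in the form that is linear in `exp h`. -/
lemma integral_le_toReal_klDiv_add {α : Type*} [MeasurableSpace α] {μ ν : Measure α}
    [IsProbabilityMeasure μ] [IsProbabilityMeasure ν] (hkl : klDiv μ ν ≠ ∞) {h : α → ℝ}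
    (hμ : Integrable h μ) (hν : Integrable (fun x => Real.exp (h x)) ν) :
    ∫ x, h x ∂μ ≤ (klDiv μ ν).toReal + (∫ x, Real.exp (h x) ∂ν - 1) := by
  obtain ⟨hac, hint⟩ := klDiv_ne_top_iff.1 hkl
  have i1 : Integrable (fun x => (μ.rnDeriv ν x).toReal * h x) ν := by
    simpa only [smul_eq_mul] using (integrable_rnDeriv_smul_iff hac).2 hμ
  have i2 := (integrable_klFun_rnDeriv_iff hac).2 hint
  have i3 : Integrable (fun x => Real.exp (h x) - 1) ν := hν.sub (integrable_const _)
  have e1 : ∫ x, h x ∂μ = ∫ x, (μ.rnDeriv ν x).toReal * h x ∂ν := by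
    simpa only [smul_eq_mul] using (integral_rnDeriv_smul hac (f := h)).symm
  have e2 : ∫ x, Real.exp (h x) ∂ν - 1 = ∫ x, (Real.exp (h x) - 1) ∂ν := by
    rw [integral_sub hν (integrable_const _)]; simp
  rw [e1, e2, toReal_klDiv_eq_integral_klFun hac, ← integral_add i2 i3]
  exact integral_mono i1 (i2.add i3) fun x => mul_le_klFun_add_exp ENNReal.toReal_nonneg _

/-- `log y` truncated to `[-n, n]`, with the value `-n` at `y = 0`. -/
noncomputable def truncLog (n : ℕ) (y : ℝ) : ℝ :=
  Real.log (max (Real.exp (-n)) (min y (Real.exp n)))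

lemma measurable_truncLog (n : ℕ) : Measurable (truncLog n) := by
  unfold truncLog; fun_prop

lemma exp_truncLog (n : ℕ) (y : ℝ) :
    Real.exp (truncLog n y) = max (Real.exp (-n)) (min y (Real.exp n)) :=
  Real.exp_log (lt_max_of_lt_left (Real.exp_pos _))

lemma abs_truncLog_le (n : ℕ) (y : ℝ) : |truncLog n y| ≤ n := by
  rw [abs_le]
  constructor
  · rw [← Real.exp_le_exp, exp_truncLog]; exact le_max_left _ _
  · rw [← Real.exp_le_exp, exp_truncLog]
    refine max_le (Real.exp_le_exp.2 ?_) (min_le_right _ _)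
    have : (0 : ℝ) ≤ n := n.cast_nonneg
    linarith

lemma tendsto_mul_truncLog {y : ℝ} (hy : 0 ≤ y) :
    Tendsto (fun n : ℕ => y * truncLog n y - (Real.exp (truncLog n y) - 1)) atTop
      (𝓝 (klFun y)) := by
  have hn : Tendsto (fun n : ℕ => (n : ℝ)) atTop atTop := tendsto_natCast_atTop_atTop
  have hexp : Tendsto (fun n : ℕ => Real.exp (n : ℝ)) atTop atTop := Real.tendsto_exp_atTop.comp hn
  have hexp' : Tendsto (fun n : ℕ => Real.exp (-(n : ℝ))) atTop (𝓝 0) :=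
    Real.tendsto_exp_neg_atTop_nhds_zero.comp hn
  rcases hy.eq_or_lt with rfl | hy
  · simp only [zero_mul, zero_sub, klFun_zero]
    have : ∀ n : ℕ, -(Real.exp (truncLog n 0) - 1) = 1 - Real.exp (-(n : ℝ)) := by
      intro n
      rw [exp_truncLog, min_eq_left (Real.exp_pos _).le, max_eq_left (Real.exp_pos _).le]
      ring
    simp_rw [this]
    simpa using hexp'.const_sub 1
  · refine tendsto_const_nhds.congr' ?_
    filter_upwards [hexp.eventually_ge_atTop y, hexp'.eventually_le_const hy] with n h1 h2
    have : truncLog n y = Real.log y := by rw [truncLog, min_eq_left h1, max_eq_right h2]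
    rw [this, Real.exp_log hy, klFun_apply]; ring

/-- Testing with `truncLog n` gives a nonnegative integrand for every `n`, as Fatou's lemma
requires. -/
lemma mul_truncLog_nonneg (y : ℝ) (n : ℕ) :
    0 ≤ y * truncLog n y - (Real.exp (truncLog n y) - 1) := by
  set z := Real.exp (truncLog n y) with hz
  have hz0 : 0 < z := Real.exp_pos _
  have hlog : truncLog n y = Real.log z := by rw [hz, Real.log_exp]
  have hkl : 0 ≤ klFun z := klFun_nonneg hz0.le
  rw [klFun_apply] at hkl
  rw [hlog]
  -- the truncation moves `y` towards `1`, so `(y - z) * log z ≥ 0`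
  suffices h : 0 ≤ (y - z) * Real.log z by nlinarith
  have hz' := exp_truncLog n y
  rw [← hz] at hz'
  have hn1 : Real.exp (-n) ≤ 1 := Real.exp_le_one_iff.2 (by simp)
  have hn2 : 1 ≤ Real.exp n := Real.one_le_exp (by simp)
  rcases le_total y 1 with h1 | h1
  · have : z ≤ 1 := by
      rw [hz']; exact max_le hn1 ((min_le_left _ _).trans h1)
    have h2 : y ≤ z := by
      rw [hz', min_eq_left (h1.trans hn2)]; exact le_max_right _ _
    exact mul_nonneg_of_nonpos_of_nonpos (by linarith) (Real.log_nonpos hz0.le this)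
  · have : 1 ≤ z := by
      rw [hz']; exact le_max_of_le_right (le_min h1 hn2)
    have h2 : z ≤ y := by
      rw [hz']; exact max_le (hn1.trans h1) (min_le_left _ _)
    exact mul_nonneg (by linarith) (Real.log_nonneg this)

lemma integrable_of_abs_le {α : Type*} [MeasurableSpace α] {μ : Measure α} [IsFiniteMeasure μ]
    {f : α → ℝ} (hf : Measurable f) (C : ℝ) (hC : ∀ x, |f x| ≤ C) : Integrable f μ :=
  Integrable.of_bound hf.aestronglyMeasurable C (ae_of_all _ hC)

lemma integrable_exp_of_abs_le {α : Type*} [MeasurableSpace α] {μ : Measure α} [IsFiniteMeasure μ]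
    {f : α → ℝ} (hf : Measurable f) (C : ℝ) (hC : ∀ x, |f x| ≤ C) :
    Integrable (fun x => Real.exp (f x)) μ :=
  integrable_of_abs_le hf.exp (Real.exp C) fun x => by
    rw [Real.abs_exp]; exact Real.exp_le_exp.2 ((abs_le.1 (hC x)).2)

/-- The converse of the Donsker–Varadhan inequality: testing with the truncated log-density
recovers the divergence, by Fatou's lemma. -/
lemma klDiv_le_of_forall_integral_le {α : Type*} [MeasurableSpace α] {μ ν : Measure α}
    [IsProbabilityMeasure μ] [IsProbabilityMeasure ν] {K : ℝ}
    (H : ∀ h : α → ℝ, Measurable h → (∃ C, ∀ x, |h x| ≤ C) →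
      ∫ x, h x ∂μ ≤ K + (∫ x, Real.exp (h x) ∂ν - 1)) :
    klDiv μ ν ≤ ENNReal.ofReal K := by
  have hac : μ ≪ ν := by
    refine Measure.AbsolutelyContinuous.mk fun A hA h0 => ?_
    by_contra hne
    have hpos : 0 < μ.real A := ENNReal.toReal_pos hne (measure_ne_top _ _)
    -- a `ν`-null set charged by `μ` is excluded by testing with large multiples of its indicator
    obtain ⟨n, hn⟩ := exists_nat_gt (K / μ.real A)
    have h1 := H (A.indicator fun _ => (n : ℝ)) (measurable_const.indicator hA)
      ⟨n, fun x => by by_cases hx : x ∈ A <;> simp [hx]⟩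
    have h2 : ∫ x, Real.exp (A.indicator (fun _ => (n : ℝ)) x) ∂ν = 1 := by
      have : (fun x => Real.exp (A.indicator (fun _ => (n : ℝ)) x)) =ᵐ[ν] fun _ => (1 : ℝ) := by
        have hnot : ∀ᵐ x ∂ν, x ∉ A := measure_eq_zero_iff_ae_notMem.1 h0
        filter_upwards [hnot] with x hx
        simp [hx]
      rw [integral_congr_ae this]; simp
    rw [integral_indicator_const _ hA, h2, smul_eq_mul] at h1
    rw [div_lt_iff₀ hpos] at hn
    nlinarith
  rw [klDiv_eq_lintegral_klFun_of_ac hac]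
  let y : α → ℝ := fun x => (μ.rnDeriv ν x).toReal
  have hy : Measurable y := (Measure.measurable_rnDeriv μ ν).ennreal_toReal
  have hy0 : ∀ x, 0 ≤ y x := fun x => ENNReal.toReal_nonneg
  let F : ℕ → α → ℝ := fun n x => y x * truncLog n (y x) - (Real.exp (truncLog n (y x)) - 1)
  have hm : ∀ n, Measurable fun x => truncLog n (y x) := fun n => (measurable_truncLog n).comp hy
  have hFm : ∀ n, Measurable (F n) := fun n =>
    (hy.mul (hm n)).sub ((hm n).exp.sub_const 1)
  have hbound : ∀ n, ∫⁻ x, ENNReal.ofReal (F n x) ∂ν ≤ ENNReal.ofReal K := by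
    intro n
    have hb := fun x => abs_truncLog_le n (y x)
    have i0 : Integrable (fun x => truncLog n (y x)) μ := integrable_of_abs_le (hm n) n hb
    have i1 : Integrable (fun x => y x * truncLog n (y x)) ν := by
      simpa only [smul_eq_mul] using (integrable_rnDeriv_smul_iff hac).2 i0
    have i2 : Integrable (fun x => Real.exp (truncLog n (y x))) ν :=
      integrable_exp_of_abs_le (hm n) n hb
    have e1 : ∫ x, y x * truncLog n (y x) ∂ν = ∫ x, truncLog n (y x) ∂μ := by
      simpa only [smul_eq_mul] using
        integral_rnDeriv_smul hac (f := fun x => truncLog n (y x))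
    have i3 : Integrable (F n) ν := i1.sub (i2.sub (integrable_const _))
    rw [← ofReal_integral_eq_lintegral_ofReal i3
      (ae_of_all _ fun x => mul_truncLog_nonneg (y x) n)]
    refine ENNReal.ofReal_le_ofReal ?_
    have e2 : ∫ x, F n x ∂ν = ∫ x, truncLog n (y x) ∂μ
        - (∫ x, Real.exp (truncLog n (y x)) ∂ν - 1) := by
      rw [← e1]
      simp only [F]
      have i4 : Integrable (fun x => Real.exp (truncLog n (y x)) - 1) ν :=
        i2.sub (integrable_const _)
      rw [integral_sub i1 i4, integral_sub i2 (integrable_const _)]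
      simp
    rw [e2]
    linarith [H _ (hm n) ⟨n, hb⟩]
  calc ∫⁻ x, ENNReal.ofReal (klFun (y x)) ∂ν
      = ∫⁻ x, liminf (fun n => ENNReal.ofReal (F n x)) atTop ∂ν := by
        refine lintegral_congr fun x => ?_
        exact (((ENNReal.continuous_ofReal.tendsto _).comp
          (tendsto_mul_truncLog (hy0 x))).liminf_eq).symm
    _ ≤ liminf (fun n => ∫⁻ x, ENNReal.ofReal (F n x) ∂ν) atTop :=
        lintegral_liminf_le fun n => (hFm n).ennreal_ofReal
    _ ≤ ENNReal.ofReal K :=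
        liminf_le_of_frequently_le' (Frequently.of_forall hbound)

/-- The Donsker–Varadhan inequality for `t` times the indicator of `B`. -/
lemma measureReal_sub_le_klDiv {α : Type*} [MeasurableSpace α] {μ ν : Measure α}
    [IsProbabilityMeasure μ] [IsProbabilityMeasure ν] (hkl : klDiv μ ν ≠ ∞) {B : Set α}
    (hB : MeasurableSet B) {t : ℝ} (ht : 0 < t) (ht1 : t ≤ 1) :
    μ.real B - ν.real B ≤ (klDiv μ ν).toReal / t + t := by
  have hm : Measurable (B.indicator fun _ => t) := measurable_const.indicator hB
  have hb : ∀ x, |B.indicator (fun _ => t) x| ≤ t := fun x => by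
    by_cases hx : x ∈ B <;> simp [hx, abs_of_pos ht, ht.le]
  have h1 := integral_le_toReal_klDiv_add hkl (integrable_of_abs_le hm t hb)
    (integrable_exp_of_abs_le hm t hb)
  have h2 : ∫ x, Real.exp (B.indicator (fun _ => t) x) ∂ν = 1 + ν.real B * (Real.exp t - 1) := by
    have : (fun x => Real.exp (B.indicator (fun _ => t) x))
        = fun x => 1 + B.indicator (fun _ => Real.exp t - 1) x := by
      ext x; by_cases hx : x ∈ B <;> simp [hx]
    rw [this, integral_add (integrable_const _) ((integrable_const _).indicator hB),
      integral_indicator_const _ hB]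
    simp
  rw [integral_indicator_const _ hB, h2, smul_eq_mul] at h1
  have h3 : Real.exp t - 1 ≤ t + t ^ 2 := by
    have := Real.abs_exp_sub_one_sub_id_le (x := t) (by rw [abs_of_pos ht]; exact ht1)
    linarith [(abs_le.1 this).2]
  have h4 : ν.real B ≤ 1 := measureReal_le_one
  have h5 : 0 ≤ ν.real B := measureReal_nonneg
  rw [← mul_le_mul_iff_left₀ ht, add_mul, div_mul_cancel₀ _ ht.ne']
  nlinarith

/-- A crude form of Pinsker's inequality. -/
lemma abs_measureReal_sub_le_klDiv {α : Type*} [MeasurableSpace α] {μ ν : Measure α}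
    [IsProbabilityMeasure μ] [IsProbabilityMeasure ν] (hkl : klDiv μ ν ≠ ∞) {B : Set α}
    (hB : MeasurableSet B) {t : ℝ} (ht : 0 < t) (ht1 : t ≤ 1) :
    |μ.real B - ν.real B| ≤ (klDiv μ ν).toReal / t + t := by
  refine abs_le.2 ⟨?_, measureReal_sub_le_klDiv hkl hB ht ht1⟩
  have := measureReal_sub_le_klDiv hkl hB.compl ht ht1
  rw [probReal_compl_eq_one_sub hB, probReal_compl_eq_one_sub hB] at this
  linarith

lemma tendsto_measureReal_sub_of_klDiv {α ι : Type*} [MeasurableSpace α] {l : Filter ι}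
    {μ ν : ι → Measure α} (hμ : ∀ᶠ i in l, IsProbabilityMeasure (μ i))
    (hν : ∀ᶠ i in l, IsProbabilityMeasure (ν i))
    (hkl : Tendsto (fun i => klDiv (μ i) (ν i)) l (𝓝 0)) {B : Set α} (hB : MeasurableSet B) :
    Tendsto (fun i => (μ i).real B - (ν i).real B) l (𝓝 0) := by
  rw [Metric.tendsto_nhds]
  intro ε hε
  set t : ℝ := min 1 (ε / 3) with ht
  have ht0 : 0 < t := lt_min one_pos (by linarith)
  have hsmall : ∀ᶠ i in l, klDiv (μ i) (ν i) < ENNReal.ofReal (t * (ε / 3)) :=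
    hkl.eventually_lt_const (ENNReal.ofReal_pos.2 (by positivity))
  filter_upwards [hμ, hν, hsmall] with i h1 h2 h3
  have hne : klDiv (μ i) (ν i) ≠ ∞ := h3.ne_top
  have h4 : (klDiv (μ i) (ν i)).toReal ≤ t * (ε / 3) :=
    ENNReal.toReal_le_of_le_ofReal (by positivity) h3.le
  rw [Real.dist_eq, sub_zero]
  have h5 : (klDiv (μ i) (ν i)).toReal / t ≤ ε / 3 := by
    rw [div_le_iff₀ ht0]; linarith
  linarith [abs_measureReal_sub_le_klDiv hne hB ht0 (min_le_left _ _), min_le_right 1 (ε / 3)]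

/-- The chain rule for log-densities. -/
lemma llr_add_llr {α : Type*} [MeasurableSpace α] {μ ν κ : Measure α} [SigmaFinite μ]
    [SigmaFinite ν] [SigmaFinite κ] (h1 : μ ≪ ν) (h2 : ν ≪ κ) :
    ∀ᵐ x ∂μ, llr μ κ x = llr μ ν x + llr ν κ x := by
  have e := (h1.trans h2).ae_le (Measure.rnDeriv_mul_rnDeriv (κ := κ) h1)
  have p1 := Measure.rnDeriv_pos h1
  have p2 := h1.ae_le (Measure.rnDeriv_pos h2)
  have t1 := h1.ae_le (Measure.rnDeriv_lt_top μ ν)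
  have t2 := (h1.trans h2).ae_le (Measure.rnDeriv_lt_top ν κ)
  filter_upwards [e, p1, p2, t1, t2] with x e p1 p2 t1 t2
  simp only [llr, ← e, Pi.mul_apply, ENNReal.toReal_mul]
  exact Real.log_mul (ENNReal.toReal_pos p1.ne' t1.ne).ne' (ENNReal.toReal_pos p2.ne' t2.ne).ne'

lemma isProbabilityMeasure_midpoint {α : Type*} [MeasurableSpace α] (μ₁ μ₂ : Measure α)
    [IsProbabilityMeasure μ₁] [IsProbabilityMeasure μ₂] :
    IsProbabilityMeasure ((2⁻¹ : ℝ≥0∞) • (μ₁ + μ₂)) := by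
  refine ⟨?_⟩
  rw [Measure.smul_apply, Measure.add_apply, measure_univ, measure_univ, smul_eq_mul,
    one_add_one_eq_two]
  exact ENNReal.inv_mul_cancel (by simp) (by simp)

lemma le_two_smul_midpoint {α : Type*} [MeasurableSpace α] (μ₁ μ₂ : Measure α) :
    μ₁ ≤ (2 : ℝ≥0∞) • ((2⁻¹ : ℝ≥0∞) • (μ₁ + μ₂)) := by
  rw [smul_smul, ENNReal.mul_inv_cancel (by simp) (by simp), one_smul]
  exact Measure.le_add_right le_rfl

lemma rnDeriv_le_of_le_smul {α : Type*} [MeasurableSpace α] {μ ν : Measure α}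
    [IsFiniteMeasure μ] [IsFiniteMeasure ν] {c : ℝ≥0∞} (h : μ ≤ c • ν) :
    ∀ᵐ x ∂ν, μ.rnDeriv ν x ≤ c := by
  have hac : μ ≪ ν := (Measure.absolutelyContinuous_of_le h).trans
    (Measure.smul_absolutelyContinuous)
  refine ae_le_of_forall_setLIntegral_le_of_sigmaFinite₀
    (Measure.measurable_rnDeriv μ ν).aemeasurable fun s hs _ => ?_
  rw [Measure.setLIntegral_rnDeriv hac, setLIntegral_const]
  exact h s

lemma klDiv_ne_top_of_le_smul {α : Type*} [MeasurableSpace α] {μ ν : Measure α}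
    [IsProbabilityMeasure μ] [IsProbabilityMeasure ν] {c : ℝ≥0∞} (hc : c ≠ ∞) (h : μ ≤ c • ν) :
    klDiv μ ν ≠ ∞ := by
  have hac : μ ≪ ν := (Measure.absolutelyContinuous_of_le h).trans
    (Measure.smul_absolutelyContinuous)
  refine klDiv_ne_top hac ((integrable_klFun_rnDeriv_iff hac).1 ?_)
  refine Integrable.of_bound (C := (c.toReal + 1) ^ 2) (measurable_klFun.comp
    (Measure.measurable_rnDeriv μ ν).ennreal_toReal).aestronglyMeasurable ?_
  filter_upwards [rnDeriv_le_of_le_smul h] with x hx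
  have h0 : 0 ≤ (μ.rnDeriv ν x).toReal := ENNReal.toReal_nonneg
  have h2 : (μ.rnDeriv ν x).toReal ≤ c.toReal := ENNReal.toReal_mono hc hx
  rw [Real.norm_of_nonneg (klFun_nonneg h0)]
  exact (klFun_le_sq h0).trans (by nlinarith)

lemma klDiv_ne_top_of_le_smul_of_ne_top {α : Type*} [MeasurableSpace α] {μ ν κ : Measure α}
    [IsProbabilityMeasure μ] [IsProbabilityMeasure ν] [IsProbabilityMeasure κ] {c : ℝ≥0∞}
    (hc : c ≠ ∞) (h : μ ≤ c • ν) (hkl : klDiv ν κ ≠ ∞) : klDiv μ κ ≠ ∞ := by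
  obtain ⟨a₁, i₁⟩ := klDiv_ne_top_iff.1 (klDiv_ne_top_of_le_smul hc h)
  obtain ⟨a₂, i₂⟩ := klDiv_ne_top_iff.1 hkl
  refine klDiv_ne_top (a₁.trans a₂) ?_
  have i₃ : Integrable (llr ν κ) μ := (i₂.smul_measure hc).mono_measure h
  exact (i₁.add i₃).congr ((llr_add_llr a₁ a₂).mono fun x hx => hx.symm)

/-- The compensation (parallelogram) identity of the Kullback–Leibler divergence. -/
lemma klDiv_midpoint {α : Type*} [MeasurableSpace α] {μ₁ μ₂ ν : Measure α}
    [IsProbabilityMeasure μ₁] [IsProbabilityMeasure μ₂] [IsProbabilityMeasure ν]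
    (h₁ : klDiv μ₁ ν ≠ ∞) (h₂ : klDiv μ₂ ν ≠ ∞) :
    klDiv ((2⁻¹ : ℝ≥0∞) • (μ₁ + μ₂)) ν ≠ ∞ ∧
    2 * (klDiv ((2⁻¹ : ℝ≥0∞) • (μ₁ + μ₂)) ν).toReal
      + (klDiv μ₁ ((2⁻¹ : ℝ≥0∞) • (μ₁ + μ₂))).toReal
      + (klDiv μ₂ ((2⁻¹ : ℝ≥0∞) • (μ₁ + μ₂))).toReal
      = (klDiv μ₁ ν).toReal + (klDiv μ₂ ν).toReal := by
  set ρ := (2⁻¹ : ℝ≥0∞) • (μ₁ + μ₂) with hρ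
  have : IsProbabilityMeasure ρ := isProbabilityMeasure_midpoint μ₁ μ₂
  have k₁ : klDiv μ₁ ρ ≠ ∞ :=
    klDiv_ne_top_of_le_smul (c := 2) (by simp) (le_two_smul_midpoint μ₁ μ₂)
  have k₂ : klDiv μ₂ ρ ≠ ∞ := klDiv_ne_top_of_le_smul (c := 2) (by simp) (by
    rw [hρ, add_comm]; exact le_two_smul_midpoint μ₂ μ₁)
  obtain ⟨a₁, i₁⟩ := klDiv_ne_top_iff.1 h₁
  obtain ⟨a₂, i₂⟩ := klDiv_ne_top_iff.1 h₂
  obtain ⟨b₁, j₁⟩ := klDiv_ne_top_iff.1 k₁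
  obtain ⟨b₂, j₂⟩ := klDiv_ne_top_iff.1 k₂
  have hac : ρ ≪ ν :=
    Measure.smul_absolutelyContinuous.trans (Measure.AbsolutelyContinuous.add_left_iff.2 ⟨a₁, a₂⟩)
  have e₁ := llr_add_llr b₁ hac
  have e₂ := llr_add_llr b₂ hac
  have l₁ : Integrable (llr ρ ν) μ₁ :=
    (i₁.sub j₁).congr (by filter_upwards [e₁] with x hx; simp [hx])
  have l₂ : Integrable (llr ρ ν) μ₂ :=
    (i₂.sub j₂).congr (by filter_upwards [e₂] with x hx; simp [hx])
  have l : Integrable (llr ρ ν) ρ := (l₁.add_measure l₂).smul_measure (by simp)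
  refine ⟨klDiv_ne_top hac l, ?_⟩
  rw [toReal_klDiv_of_measure_eq hac (by simp), toReal_klDiv_of_measure_eq a₁ (by simp),
    toReal_klDiv_of_measure_eq a₂ (by simp), toReal_klDiv_of_measure_eq b₁ (by simp),
    toReal_klDiv_of_measure_eq b₂ (by simp), integral_congr_ae e₁, integral_congr_ae e₂,
    integral_add j₁ l₁, integral_add j₂ l₂]
  have : ∫ x, llr ρ ν x ∂ρ = 2⁻¹ * (∫ x, llr ρ ν x ∂μ₁ + ∫ x, llr ρ ν x ∂μ₂) := by
    conv_lhs => rw [hρ]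
    rw [integral_smul_measure, integral_add_measure l₁ l₂]
    simp
  rw [this]; ring

/-! ### Product measures and marginals -/

lemma lintegral_pi_prod {D : ℕ} (n : Fin D → Measure ℝ) [∀ i, IsProbabilityMeasure (n i)]
    {f : Fin D → ℝ → ℝ≥0∞} (hf : ∀ i, Measurable (f i)) :
    ∫⁻ θ, ∏ i, f i (θ i) ∂(Measure.pi n) = ∏ i, ∫⁻ x, f i x ∂(n i) := by
  rw [ProbabilityTheory.lintegral_prod_eq_prod_lintegral_of_indepFun Finset.univ
    (fun i (θ : Fin D → ℝ) => f i (θ i))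
    (ProbabilityTheory.iIndepFun_pi fun i => (hf i).aemeasurable)
    fun i => (hf i).comp (measurable_pi_apply i)]
  exact Finset.prod_congr rfl fun i _ => (measurePreserving_eval n i).lintegral_comp (hf i)

lemma pi_withDensity {D : ℕ} (n : Fin D → Measure ℝ) [∀ i, IsProbabilityMeasure (n i)]
    {f : Fin D → ℝ → ℝ≥0∞} (hf : ∀ i, Measurable (f i))
    [∀ i, IsFiniteMeasure ((n i).withDensity (f i))] :
    Measure.pi (fun i => (n i).withDensity (f i))
      = (Measure.pi n).withDensity (fun θ => ∏ i, f i (θ i)) := by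
  refine Measure.pi_eq fun s hs => ?_
  have hfi : ∀ i, Measurable fun θ : Fin D → ℝ => f i (θ i) := fun i =>
    (hf i).comp (measurable_pi_apply i)
  rw [withDensity_apply _ (MeasurableSet.univ_pi hs),
    ← lintegral_indicator (MeasurableSet.univ_pi hs)]
  have e : (Set.univ.pi s).indicator (fun θ : Fin D → ℝ => ∏ i, f i (θ i))
      = fun θ => ∏ i, (s i).indicator (f i) (θ i) := by
    ext θ
    by_cases h : θ ∈ Set.univ.pi s
    · rw [Set.indicator_of_mem h]
      exact Finset.prod_congr rfl fun i _ => (Set.indicator_of_mem (h i (Set.mem_univ i)) _).symm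
    · rw [Set.indicator_of_notMem h]
      obtain ⟨i, hi⟩ : ∃ i, θ i ∉ s i := by simpa [Set.mem_pi] using h
      exact (Finset.prod_eq_zero (Finset.mem_univ i) (Set.indicator_of_notMem hi _)).symm
  rw [e, lintegral_pi_prod n fun i => (hf i).indicator (hs i)]
  exact Finset.prod_congr rfl fun i _ => by
    rw [lintegral_indicator (hs i), withDensity_apply _ (hs i)]

lemma pi_eq_withDensity_rnDeriv {D : ℕ} {m n : Fin D → Measure ℝ}
    [∀ i, IsFiniteMeasure (m i)] [∀ i, IsProbabilityMeasure (n i)] (h : ∀ i, m i ≪ n i) :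
    Measure.pi m = (Measure.pi n).withDensity (fun θ => ∏ i, (m i).rnDeriv (n i) (θ i)) := by
  have e : ∀ i, (n i).withDensity ((m i).rnDeriv (n i)) = m i := fun i =>
    Measure.withDensity_rnDeriv_eq _ _ (h i)
  have : ∀ i, IsFiniteMeasure ((n i).withDensity ((m i).rnDeriv (n i))) := fun i => by
    rw [e i]; infer_instance
  rw [← pi_withDensity n fun i => Measure.measurable_rnDeriv _ _]
  simp_rw [e]

lemma pi_absolutelyContinuous {D : ℕ} {m n : Fin D → Measure ℝ}
    [∀ i, IsFiniteMeasure (m i)] [∀ i, IsProbabilityMeasure (n i)] (h : ∀ i, m i ≪ n i) :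
    Measure.pi m ≪ Measure.pi n := by
  rw [pi_eq_withDensity_rnDeriv h]
  exact withDensity_absolutelyContinuous _ _

lemma pi_le_smul_pi {D : ℕ} {m n : Fin D → Measure ℝ}
    [∀ i, IsFiniteMeasure (m i)] [∀ i, IsProbabilityMeasure (n i)] {c : ℝ≥0∞}
    (h : ∀ i, m i ≤ c • n i) : Measure.pi m ≤ c ^ D • Measure.pi n := by
  have hac : ∀ i, m i ≪ n i := fun i => (Measure.absolutelyContinuous_of_le (h i)).trans
    Measure.smul_absolutelyContinuous
  rw [pi_eq_withDensity_rnDeriv hac, ← withDensity_const]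
  refine withDensity_mono ?_
  have : ∀ᵐ θ ∂(Measure.pi n), ∀ i, (m i).rnDeriv (n i) (θ i) ≤ c :=
    ae_all_iff.2 fun i => Measure.tendsto_eval_ae_ae.eventually (rnDeriv_le_of_le_smul (h i))
  filter_upwards [this] with θ hθ
  calc ∏ i, (m i).rnDeriv (n i) (θ i) ≤ ∏ _i : Fin D, c := Finset.prod_le_prod' fun i _ => hθ i
    _ = c ^ D := by simp

lemma llr_pi {D : ℕ} {m n : Fin D → Measure ℝ}
    [∀ i, IsFiniteMeasure (m i)] [∀ i, IsProbabilityMeasure (n i)] (h : ∀ i, m i ≪ n i) :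
    ∀ᵐ θ ∂(Measure.pi m), llr (Measure.pi m) (Measure.pi n) θ
      = ∑ i, llr (m i) (n i) (θ i) := by
  have hm : Measurable fun θ : Fin D → ℝ => ∏ i, (m i).rnDeriv (n i) (θ i) :=
    Finset.measurable_prod _ fun i _ =>
      (Measure.measurable_rnDeriv _ _).comp (measurable_pi_apply i)
  have e := (Measure.pi n).rnDeriv_withDensity hm
  rw [← pi_eq_withDensity_rnDeriv h] at e
  have hp : ∀ᵐ θ ∂(Measure.pi m), ∀ i, (m i).rnDeriv (n i) (θ i) ≠ 0 ∧
      (m i).rnDeriv (n i) (θ i) ≠ ∞ := ae_all_iff.2 fun i => by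
    refine (Measure.tendsto_eval_ae_ae (μ := m) (i := i)).eventually
      (p := fun x => (m i).rnDeriv (n i) x ≠ 0 ∧ (m i).rnDeriv (n i) x ≠ ∞) ?_
    filter_upwards [Measure.rnDeriv_pos (h i), (h i).ae_le (Measure.rnDeriv_lt_top (m i) (n i))]
      with x h1 h2 using ⟨h1.ne', h2.ne⟩
  filter_upwards [(pi_absolutelyContinuous h).ae_le e, hp] with θ hθ hpθ
  simp only [llr, hθ, ENNReal.toReal_prod]
  exact Real.log_prod fun i _ => (ENNReal.toReal_pos (hpθ i).1 (hpθ i).2).ne'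

instance isProbabilityMeasure_marginals {D : ℕ} (q : Measure (Fin D → ℝ))
    [IsProbabilityMeasure q] (i : Fin D) : IsProbabilityMeasure (marginals q i) :=
  Measure.isProbabilityMeasure_map (measurable_pi_apply i).aemeasurable

lemma marginals_apply {D : ℕ} (q : Measure (Fin D → ℝ)) (i : Fin D) {A : Set ℝ}
    (hA : MeasurableSet A) : marginals q i A = q ((fun θ => θ i) ⁻¹' A) :=
  Measure.map_apply (measurable_pi_apply i) hA

lemma marginals_pi {D : ℕ} (m : Fin D → Measure ℝ) [∀ i, IsProbabilityMeasure (m i)] :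
    marginals (Measure.pi m) = m :=
  funext fun i => (measurePreserving_eval m i).map_eq

lemma marginals_absolutelyContinuous {D : ℕ} {q r : Measure (Fin D → ℝ)} (h : q ≪ r)
    (i : Fin D) : marginals q i ≪ marginals r i :=
  h.map (measurable_pi_apply i)

lemma ae_of_ae_marginals {D : ℕ} {q : Measure (Fin D → ℝ)} {i : Fin D} {p : ℝ → Prop}
    (h : ∀ᵐ x ∂(marginals q i), p x) : ∀ᵐ θ ∂q, p (θ i) :=
  ae_of_ae_map (measurable_pi_apply i).aemeasurable h

lemma integrable_eval_iff {D : ℕ} {q : Measure (Fin D → ℝ)} {i : Fin D} {f : ℝ → ℝ}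
    (hf : Measurable f) : Integrable (fun θ => f (θ i)) q ↔ Integrable f (marginals q i) :=
  (integrable_map_measure hf.aestronglyMeasurable (measurable_pi_apply i).aemeasurable).symm

lemma integral_eval {D : ℕ} {q : Measure (Fin D → ℝ)} {i : Fin D} {f : ℝ → ℝ}
    (hf : Measurable f) : ∫ θ, f (θ i) ∂q = ∫ x, f x ∂(marginals q i) :=
  (integral_map (measurable_pi_apply i).aemeasurable hf.aestronglyMeasurable).symm

lemma absolutelyContinuous_pi_marginals {D : ℕ} {q : Measure (Fin D → ℝ)}
    [IsProbabilityMeasure q] {n : Fin D → Measure ℝ} [∀ i, IsProbabilityMeasure (n i)]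
    (h : q ≪ Measure.pi n) : q ≪ Measure.pi (marginals q) := by
  have hi : ∀ i, marginals q i ≪ n i := fun i => by
    have := marginals_absolutelyContinuous h i
    rwa [marginals_pi] at this
  rw [pi_eq_withDensity_rnDeriv hi]
  have hm : Measurable fun θ : Fin D → ℝ => ∏ i, (marginals q i).rnDeriv (n i) (θ i) :=
    Finset.measurable_prod _ fun i _ =>
      (Measure.measurable_rnDeriv _ _).comp (measurable_pi_apply i)
  refine Measure.AbsolutelyContinuous.mk fun A _ hA => ?_
  rw [withDensity_apply_eq_zero hm] at hA
  -- under `q` the density of the product of its marginals is almost surely positive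
  have hpos : ∀ᵐ θ ∂q, (∏ i, (marginals q i).rnDeriv (n i) (θ i)) ≠ 0 := by
    have : ∀ᵐ θ ∂q, ∀ i, (marginals q i).rnDeriv (n i) (θ i) ≠ 0 :=
      ae_all_iff.2 fun i =>
        ae_of_ae_marginals ((Measure.rnDeriv_pos (hi i)).mono fun x hx => hx.ne')
    filter_upwards [this] with θ hθ using Finset.prod_ne_zero_iff.2 fun i _ => hθ i
  have h0 := h hA
  refine le_antisymm ?_ zero_le
  calc q A ≤ q ({θ | ∏ i, (marginals q i).rnDeriv (n i) (θ i) ≠ 0} ∩ A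
        ∪ {θ | ¬ ∏ i, (marginals q i).rnDeriv (n i) (θ i) ≠ 0}) := by
        refine measure_mono fun θ hθ => ?_
        by_cases hx : ∏ i, (marginals q i).rnDeriv (n i) (θ i) ≠ 0
        · exact Or.inl ⟨hx, hθ⟩
        · exact Or.inr hx
    _ ≤ 0 := (measure_union_le _ _).trans (by rw [h0, ae_iff.1 hpos, add_zero])

/-- Among all product measures, the product of the marginals of `q` is the one closest to `q`. -/
lemma klDiv_pi_marginals_le {D : ℕ} (q : Measure (Fin D → ℝ)) [IsProbabilityMeasure q]
    (n : Fin D → Measure ℝ) [∀ i, IsProbabilityMeasure (n i)] :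
    klDiv q (Measure.pi (marginals q)) ≤ klDiv q (Measure.pi n) := by
  by_cases hkl : klDiv q (Measure.pi n) = ∞
  · rw [hkl]; exact le_top
  obtain ⟨hac, hint⟩ := klDiv_ne_top_iff.1 hkl
  have hi : ∀ i, marginals q i ≪ n i := fun i => by
    have := marginals_absolutelyContinuous hac i
    rwa [marginals_pi] at this
  have hqm := absolutelyContinuous_pi_marginals hac
  have hb : ∀ i, Integrable (llr (marginals q i) (n i)) (marginals q i) := fun i => by
    have h1 : klDiv (marginals q i) (n i) ≤ klDiv q (Measure.pi n) := by
      have h2 := klDiv_map_le q (Measure.pi n) (measurable_pi_apply (X := fun _ : Fin D => ℝ) i)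
      have h3 : (Measure.pi n).map (fun θ : Fin D → ℝ => θ i) = n i :=
        congrFun (marginals_pi n) i
      rwa [h3] at h2
    exact (klDiv_ne_top_iff.1 (ne_top_of_le_ne_top hkl h1)).2
  have hsum : Integrable (fun θ : Fin D → ℝ => ∑ i, llr (marginals q i) (n i) (θ i)) q :=
    integrable_finsetSum _ fun i _ => (integrable_eval_iff (measurable_llr _ _)).2 (hb i)
  have e : ∀ᵐ θ ∂q, llr q (Measure.pi n) θ
      = llr q (Measure.pi (marginals q)) θ + ∑ i, llr (marginals q i) (n i) (θ i) := by
    filter_upwards [llr_add_llr hqm (pi_absolutelyContinuous hi), hqm.ae_le (llr_pi hi)]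
      with θ h1 h2
    rw [h1, h2]
  have hA : Integrable (llr q (Measure.pi (marginals q))) q :=
    (hint.sub hsum).congr (by filter_upwards [e] with x hx; simp [hx])
  rw [← ENNReal.toReal_le_toReal (klDiv_ne_top hqm hA) hkl,
    toReal_klDiv_of_measure_eq hqm (by simp), toReal_klDiv_of_measure_eq hac (by simp),
    integral_congr_ae e, integral_add hA hsum]
  have : 0 ≤ ∫ θ, ∑ i, llr (marginals q i) (n i) (θ i) ∂q := by
    rw [integral_finsetSum _ fun i _ => (integrable_eval_iff (measurable_llr _ _)).2 (hb i)]
    refine Finset.sum_nonneg fun i _ => ?_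
    rw [integral_eval (measurable_llr _ _), ← toReal_klDiv_of_measure_eq (hi i) (by simp)]
    exact ENNReal.toReal_nonneg
  linarith

/-- If a separable function `∑ ψ i (θ i)` is bounded above by an integrable function with respect
to a product measure, then every summand has an integrable positive part: on a product event of
positive probability all other summands are bounded below. -/
lemma integrable_posPart_of_sum_le {D : ℕ} {m : Fin D → Measure ℝ}
    [∀ i, IsProbabilityMeasure (m i)] {ψ : Fin D → ℝ → ℝ} (hψ : ∀ i, Measurable (ψ i))
    {h : (Fin D → ℝ) → ℝ} (hh : Integrable h (Measure.pi m))
    (hle : ∀ᵐ θ ∂(Measure.pi m), ∑ i, ψ i (θ i) ≤ h θ) (i : Fin D) :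
    Integrable (fun x => max (ψ i x) 0) (m i) := by
  classical
  have hM : ∀ j, ∃ M : ℕ, m j {x | -(M : ℝ) ≤ ψ j x} ≠ 0 := by
    intro j
    by_contra! hall
    have hU : (⋃ M : ℕ, {x | -(M : ℝ) ≤ ψ j x}) = Set.univ := by
      ext x
      simp only [Set.mem_iUnion, Set.mem_ofPred_eq, Set.mem_univ, iff_true]
      obtain ⟨M, hM⟩ := exists_nat_ge (-ψ j x)
      exact ⟨M, by linarith⟩
    have := measure_iUnion_null hall
    rw [hU, measure_univ] at this
    exact one_ne_zero this
  choose M hM using hM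
  let C : ℝ := ∑ j, (M j : ℝ)
  have hsm : ∀ j, MeasurableSet {x | -(M j : ℝ) ≤ ψ j x} := fun j =>
    measurableSet_le measurable_const (hψ j)
  let f : Fin D → ℝ → ℝ≥0∞ := fun j =>
    if j = i then fun x => ENNReal.ofReal (max (ψ i x) 0)
    else {x | -(M j : ℝ) ≤ ψ j x}.indicator 1
  have hf : ∀ j, Measurable (f j) := by
    intro j
    by_cases hj : j = i
    · simp only [f, hj, if_true]
      exact ((hψ i).max measurable_const).ennreal_ofReal
    · simp only [f, hj, if_false]
      exact measurable_one.indicator (hsm j)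
  have hbound : ∀ᵐ θ ∂(Measure.pi m), ∏ j, f j (θ j) ≤ ENNReal.ofReal (|h θ| + C) := by
    filter_upwards [hle] with θ hθ
    have hC : 0 ≤ C := Finset.sum_nonneg fun _ _ => by positivity
    by_cases hall : ∀ j ≠ i, -(M j : ℝ) ≤ ψ j (θ j)
    · have : ∏ j, f j (θ j) = ENNReal.ofReal (max (ψ i (θ i)) 0) := by
        rw [← Finset.mul_prod_erase _ _ (Finset.mem_univ i)]
        rw [Finset.prod_eq_one fun j hj => ?_]
        · simp [f]
        · have hji := Finset.ne_of_mem_erase hj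
          simp [f, hji, hall j hji]
      rw [this]
      refine ENNReal.ofReal_le_ofReal (max_le ?_ (by positivity))
      have h1 : ∑ j, ψ j (θ j) = ψ i (θ i) + ∑ j ∈ Finset.univ.erase i, ψ j (θ j) :=
        (Finset.add_sum_erase _ _ (Finset.mem_univ i)).symm
      have h2 : -C ≤ ∑ j ∈ Finset.univ.erase i, ψ j (θ j) := by
        calc -C ≤ -∑ j ∈ Finset.univ.erase i, (M j : ℝ) := by
              refine neg_le_neg (Finset.sum_le_sum_of_subset_of_nonneg (Finset.erase_subset _ _)
                fun _ _ _ => by positivity)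
          _ = ∑ j ∈ Finset.univ.erase i, -(M j : ℝ) := by rw [Finset.sum_neg_distrib]
          _ ≤ _ := Finset.sum_le_sum fun j hj => hall j (Finset.ne_of_mem_erase hj)
      linarith [le_abs_self (h θ)]
    · push Not at hall
      obtain ⟨j, hj, hlt⟩ := hall
      rw [Finset.prod_eq_zero (Finset.mem_univ j)]
      · exact zero_le
      · simp [f, hj, hlt]
  have hfin : ∏ j, ∫⁻ x, f j x ∂(m j) < ∞ := by
    rw [← lintegral_pi_prod m hf]
    refine (lintegral_mono_ae hbound).trans_lt ?_
    exact (hh.abs.add (integrable_const C)).lintegral_lt_top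
  have hne : ∏ j ∈ Finset.univ.erase i, ∫⁻ x, f j x ∂(m j) ≠ 0 := by
    refine Finset.prod_ne_zero_iff.2 fun j hj => ?_
    have hji := Finset.ne_of_mem_erase hj
    simp only [f, hji, if_false]
    rw [lintegral_indicator_one (hsm j)]
    exact hM j
  rw [← Finset.mul_prod_erase _ _ (Finset.mem_univ i)] at hfin
  have hlt : ∫⁻ x, f i x ∂(m i) < ∞ := by
    by_contra htop
    rw [not_lt, top_le_iff] at htop
    rw [htop, ENNReal.top_mul hne] at hfin
    exact lt_irrefl _ hfin
  refine ⟨((hψ i).max measurable_const).aestronglyMeasurable, ?_⟩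
  rw [hasFiniteIntegral_iff_ofReal (ae_of_all _ fun x => le_max_right (ψ i x) (0 : ℝ))]
  simpa [f] using hlt

/-- Integrability of a separable function under one coupling passes to the summands, once the
function is bounded above by an integrable function under the product measure. (Under couplings
alone this fails for three or more marginals.) -/
lemma integrable_of_integrable_sum {D : ℕ} {m : Fin D → Measure ℝ}
    [∀ i, IsProbabilityMeasure (m i)] {ψ : Fin D → ℝ → ℝ} (hψ : ∀ i, Measurable (ψ i))
    {h : (Fin D → ℝ) → ℝ} (hh : Integrable h (Measure.pi m))
    (hle : ∀ᵐ θ ∂(Measure.pi m), ∑ i, ψ i (θ i) ≤ h θ)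
    {q : Measure (Fin D → ℝ)} (hq : marginals q = m)
    (hint : Integrable (fun θ => ∑ i, ψ i (θ i)) q) (i : Fin D) : Integrable (ψ i) (m i) := by
  subst hq
  have hpos : ∀ j, Integrable (fun θ : Fin D → ℝ => max (ψ j (θ j)) 0) q := fun j =>
    (integrable_eval_iff ((hψ j).max measurable_const)).2
      (integrable_posPart_of_sum_le hψ hh hle j)
  have hdom : Integrable (fun θ : Fin D → ℝ =>
      |∑ j, ψ j (θ j)| + ∑ j, max (ψ j (θ j)) 0) q :=
    hint.abs.add (integrable_finsetSum _ fun j _ => hpos j)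
  refine (integrable_eval_iff (hψ i)).1 (hdom.mono'
    ((hψ i).comp (measurable_pi_apply i)).aestronglyMeasurable (ae_of_all _ fun θ => ?_))
  rw [Real.norm_eq_abs]
  have h1 : ∑ j, ψ j (θ j) = ψ i (θ i) + ∑ j ∈ Finset.univ.erase i, ψ j (θ j) :=
    (Finset.add_sum_erase _ _ (Finset.mem_univ i)).symm
  have h2 : ∑ j, max (ψ j (θ j)) 0
      = max (ψ i (θ i)) 0 + ∑ j ∈ Finset.univ.erase i, max (ψ j (θ j)) 0 :=
    (Finset.add_sum_erase _ _ (Finset.mem_univ i)).symm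
  have h3 : ∑ j ∈ Finset.univ.erase i, ψ j (θ j)
      ≤ ∑ j ∈ Finset.univ.erase i, max (ψ j (θ j)) 0 :=
    Finset.sum_le_sum fun _ _ => le_max_left _ _
  have h4 : 0 ≤ ∑ j ∈ Finset.univ.erase i, max (ψ j (θ j)) 0 :=
    Finset.sum_nonneg fun _ _ => le_max_right _ _
  have h5 := neg_abs_le (∑ j, ψ j (θ j))
  have h6 := abs_nonneg (∑ j, ψ j (θ j))
  exact abs_le.2 ⟨by linarith [le_max_right (ψ i (θ i)) 0], by linarith [le_max_left (ψ i (θ i)) 0]⟩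

/-! ### Variational posteriors as geometric means -/

lemma mem_probMeasures_of_absolutelyContinuous {D : ℕ} {Θ : Fin D → Set ℝ}
    {q₀ μ : Measure (Fin D → ℝ)} (h₀ : q₀ ∈ probMeasures Θ) [IsProbabilityMeasure μ]
    (h : μ ≪ q₀) : μ ∈ probMeasures Θ :=
  ⟨inferInstance, h.trans h₀.2.1, h h₀.2.2⟩

lemma lintegral_euclSq_eq_sum {D : ℕ} (q : Measure (Fin D → ℝ)) :
    ∫⁻ θ, ENNReal.ofReal (euclSq θ) ∂q = ∑ i, ∫⁻ x, ENNReal.ofReal (x ^ 2) ∂(marginals q i) := by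
  have : ∀ θ : Fin D → ℝ, ENNReal.ofReal (euclSq θ) = ∑ i, ENNReal.ofReal (θ i ^ 2) := fun θ =>
    ENNReal.ofReal_sum_of_nonneg fun _ _ => sq_nonneg _
  simp_rw [this]
  rw [lintegral_finsetSum _ fun i _ => by fun_prop]
  refine Finset.sum_congr rfl fun i _ => ?_
  rw [marginals, lintegral_map (by fun_prop) (measurable_pi_apply i)]

lemma lintegral_euclSq_pi_marginals {D : ℕ} (q : Measure (Fin D → ℝ)) [IsProbabilityMeasure q] :
    ∫⁻ θ, ENNReal.ofReal (euclSq θ) ∂(Measure.pi (marginals q))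
      = ∫⁻ θ, ENNReal.ofReal (euclSq θ) ∂q := by
  rw [lintegral_euclSq_eq_sum, lintegral_euclSq_eq_sum, marginals_pi]

lemma rpow_le_add_mul {a r : ℝ} (ha0 : 0 ≤ a) (ha1 : a ≤ 1) (hr : 0 ≤ r) : r ^ a ≤ 1 + r := by
  have := Real.geom_mean_le_arith_mean2_weighted (by linarith : 0 ≤ 1 - a) ha0 zero_le_one hr
    (by ring)
  rw [Real.one_rpow, one_mul] at this
  nlinarith

lemma abs_rpow_mul_log_le {a r : ℝ} (ha0 : 0 < a) (ha1 : a < 1) (hr : 0 ≤ r) :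
    |r ^ a * Real.log r| ≤ r / (1 - a) + 1 / a := by
  have h1a : 0 < 1 - a := by linarith
  rcases hr.eq_or_lt with rfl | hr
  · simp [ha0.le]
  have hp : 0 < r ^ a := Real.rpow_pos_of_pos hr a
  have u1 := Real.log_le_rpow_div hr.le h1a
  have u2 := Real.log_le_rpow_div (inv_pos.2 hr).le ha0
  rw [Real.log_inv, Real.inv_rpow hr.le] at u2
  have e1 : r ^ a * (r ^ (1 - a) / (1 - a)) = r / (1 - a) := by
    rw [← mul_div_assoc, ← Real.rpow_add hr]; simp
  have e2 : r ^ a * ((r ^ a)⁻¹ / a) = 1 / a := by field_simp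
  have v1 := mul_le_mul_of_nonneg_left u1 hp.le
  have v2 := mul_le_mul_of_nonneg_left u2 hp.le
  rw [e1] at v1
  rw [e2] at v2
  have w1 : 0 < r / (1 - a) := by positivity
  have w2 : 0 < 1 / a := by positivity
  exact abs_le.2 ⟨by linarith, by linarith⟩

/-- The normalized geometric mean `ν ∝ q₀^(1-a) m^a` of two probability measures. A weighted sum of
divergences to `q₀` and `m` is, up to the constant `log Z`, the divergence to `ν`. -/
lemma exists_geometricMean {α : Type*} [MeasurableSpace α] {q₀ m : Measure α}
    [IsProbabilityMeasure q₀] [IsProbabilityMeasure m] (hac : m ≪ q₀) {a : ℝ} (ha0 : 0 < a)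
    (ha1 : a < 1) :
    ∃ (Z : ℝ) (ν : Measure α), 0 < Z ∧
      ν = q₀.withDensity (fun x => ENNReal.ofReal ((m.rnDeriv q₀ x).toReal ^ a / Z)) ∧
      IsProbabilityMeasure ν ∧ ν ≤ ENNReal.ofReal Z⁻¹ • (q₀ + m) ∧
      klDiv ν q₀ ≠ ∞ ∧ klDiv ν m ≠ ∞ ∧
      ∀ q : Measure α, IsProbabilityMeasure q → klDiv q q₀ ≠ ∞ → klDiv q m ≠ ∞ →
        klDiv q ν ≠ ∞ ∧
        (1 - a) * (klDiv q q₀).toReal + a * (klDiv q m).toReal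
          = (klDiv q ν).toReal - Real.log Z := by
  let ρ : α → ℝ := fun x => (m.rnDeriv q₀ x).toReal
  have hρm : Measurable ρ := (Measure.measurable_rnDeriv m q₀).ennreal_toReal
  have hρ0 : ∀ x, 0 ≤ ρ x := fun x => ENNReal.toReal_nonneg
  have hρi : Integrable ρ q₀ := Measure.integrable_toReal_rnDeriv
  have hpm : Measurable fun x => ρ x ^ a := hρm.pow_const a
  have hp0 : ∀ x, 0 ≤ ρ x ^ a := fun x => Real.rpow_nonneg (hρ0 x) a
  have hpi : Integrable (fun x => ρ x ^ a) q₀ := by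
    refine ((integrable_const (1 : ℝ)).add hρi).mono' hpm.aestronglyMeasurable
      (ae_of_all _ fun x => ?_)
    rw [Real.norm_of_nonneg (hp0 x)]
    exact rpow_le_add_mul ha0.le ha1.le (hρ0 x)
  have hmρ : m = q₀.withDensity (fun x => ENNReal.ofReal (ρ x)) := by
    conv_lhs => rw [← Measure.withDensity_rnDeriv_eq m q₀ hac]
    refine withDensity_congr_ae ?_
    filter_upwards [Measure.rnDeriv_lt_top m q₀] with x hx
    exact (ENNReal.ofReal_toReal hx.ne).symm
  let Z : ℝ := ∫ x, ρ x ^ a ∂q₀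
  have hZ : 0 < Z := by
    refine (integral_nonneg hp0).lt_of_ne' fun h0 => ?_
    have hz := (integral_eq_zero_iff_of_nonneg hp0 hpi).1 h0
    have : m = 0 := by
      rw [hmρ, withDensity_eq_zero_iff hρm.ennreal_ofReal.aemeasurable]
      filter_upwards [hz] with x hx
      have : ρ x = 0 := by
        by_contra hne
        exact (Real.rpow_pos_of_pos ((hρ0 x).lt_of_ne' hne) a).ne' hx
      simp [this]
    exact IsProbabilityMeasure.ne_zero m this
  let s : α → ℝ := fun x => ρ x ^ a / Z
  have hsm : Measurable s := hpm.div_const Z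
  have hs0 : ∀ x, 0 ≤ s x := fun x => div_nonneg (hp0 x) hZ.le
  let ν : Measure α := q₀.withDensity (fun x => ENNReal.ofReal (s x))
  have hνprob : IsProbabilityMeasure ν := by
    refine ⟨?_⟩
    rw [withDensity_apply _ MeasurableSet.univ, setLIntegral_univ,
      ← ofReal_integral_eq_lintegral_ofReal (hpi.div_const Z) (ae_of_all _ hs0), integral_div,
      div_self hZ.ne', ENNReal.ofReal_one]
  have hνq₀ : ν ≪ q₀ := withDensity_absolutelyContinuous _ _
  -- `ν` and `m` have the same null sets
  have hνm : ∀ A, ν A = 0 ↔ m A = 0 := by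
    intro A
    conv_rhs => rw [hmρ]
    rw [withDensity_apply_eq_zero hsm.ennreal_ofReal,
      withDensity_apply_eq_zero hρm.ennreal_ofReal]
    have : {x | ENNReal.ofReal (s x) ≠ 0} = {x | ENNReal.ofReal (ρ x) ≠ 0} := by
      ext x
      simp only [Set.mem_ofPred_eq, ne_eq, ENNReal.ofReal_eq_zero, not_le, s]
      constructor
      · intro h
        refine (hρ0 x).lt_of_ne' fun h0 => ?_
        rw [h0, Real.zero_rpow ha0.ne', zero_div] at h
        exact lt_irrefl _ h
      · intro h
        exact div_pos (Real.rpow_pos_of_pos h a) hZ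
    rw [this]
  have hac1 : m ≪ ν := fun A hA => (hνm A).1 hA
  have hac2 : ν ≪ m := fun A hA => (hνm A).2 hA
  have hllrν : ∀ᵐ x ∂m, llr ν q₀ x = a * llr m q₀ x - Real.log Z := by
    filter_upwards [hac.ae_le (q₀.rnDeriv_withDensity hsm.ennreal_ofReal), Measure.rnDeriv_pos hac,
      hac.ae_le (Measure.rnDeriv_lt_top m q₀)] with x h1 h2 h3
    have hpos : 0 < ρ x := ENNReal.toReal_pos h2.ne' h3.ne
    simp only [llr, ν, h1, ENNReal.toReal_ofReal (hs0 x)]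
    rw [Real.log_div (Real.rpow_pos_of_pos hpos a).ne' hZ.ne', Real.log_rpow hpos]
  have hlogint : Integrable (llr m q₀) ν := by
    rw [integrable_withDensity_iff_integrable_smul₀' hsm.ennreal_ofReal.aemeasurable
      (ae_of_all _ fun x => ENNReal.ofReal_lt_top)]
    have : Integrable (fun x => (ρ x / (1 - a) + 1 / a) / Z) q₀ :=
      ((hρi.div_const _).add (integrable_const _)).div_const _
    refine this.mono' ((hsm.ennreal_ofReal.ennreal_toReal.smul
      (measurable_llr m q₀)).aestronglyMeasurable) (ae_of_all _ fun x => ?_)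
    rw [ENNReal.toReal_ofReal (hs0 x), smul_eq_mul, Real.norm_eq_abs]
    have e : s x * llr m q₀ x = ρ x ^ a * Real.log (ρ x) / Z := by
      simp only [s, llr, ρ]; ring
    rw [e, abs_div, abs_of_pos hZ]
    exact div_le_div_of_nonneg_right (abs_rpow_mul_log_le ha0 ha1 (hρ0 x)) hZ.le
  have i1 : Integrable (llr ν q₀) ν :=
    ((hlogint.const_mul a).sub (integrable_const (Real.log Z))).congr (by
      filter_upwards [hac2.ae_le hllrν] with x hx
      simp [hx])
  have i2 : Integrable (llr ν m) ν :=
    (i1.sub hlogint).congr (by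
      filter_upwards [llr_add_llr hac2 hac] with x hx
      simp [hx])
  refine ⟨Z, ν, hZ, rfl, hνprob, ?_, klDiv_ne_top hνq₀ i1, klDiv_ne_top hac2 i2, ?_⟩
  · have e : ENNReal.ofReal Z⁻¹ • (q₀ + m)
        = q₀.withDensity (fun x => ENNReal.ofReal (Z⁻¹ * (1 + ρ x))) := by
      have : (fun x => ENNReal.ofReal (Z⁻¹ * (1 + ρ x)))
          = ENNReal.ofReal Z⁻¹ • ((1 : α → ℝ≥0∞) + fun x => ENNReal.ofReal (ρ x)) := by
        ext x
        rw [ENNReal.ofReal_mul (inv_nonneg.2 hZ.le), ENNReal.ofReal_add zero_le_one (hρ0 x)]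
        simp
      rw [this, withDensity_smul _ (measurable_one.add hρm.ennreal_ofReal),
        withDensity_add_left measurable_one, withDensity_one, ← hmρ]
    rw [e]
    refine withDensity_mono (ae_of_all _ fun x => ENNReal.ofReal_le_ofReal ?_)
    simp only [s]
    rw [div_eq_inv_mul]
    exact mul_le_mul_of_nonneg_left (rpow_le_add_mul ha0.le ha1.le (hρ0 x)) (inv_nonneg.2 hZ.le)
  · intro q hq hk1 hk2
    obtain ⟨b1, j1⟩ := klDiv_ne_top_iff.1 hk1
    obtain ⟨b2, j2⟩ := klDiv_ne_top_iff.1 hk2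
    have hqν : q ≪ ν := b2.trans hac1
    have e : ∀ᵐ x ∂q, llr q ν x
        = ((1 - a) * llr q q₀ x + a * llr q m x) + Real.log Z := by
      filter_upwards [llr_add_llr b2 hac, llr_add_llr hqν hνq₀, b2.ae_le hllrν] with x h1 h2 h3
      rw [h3] at h2
      linear_combination -h2 + (a : ℝ) * h1
    have j3 : Integrable (fun x => (1 - a) * llr q q₀ x + a * llr q m x) q :=
      (j1.const_mul _).add (j2.const_mul _)
    refine ⟨klDiv_ne_top hqν ((j3.add (integrable_const _)).congr (e.mono fun _ h => h.symm)), ?_⟩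
    rw [toReal_klDiv_of_measure_eq b1 (by simp), toReal_klDiv_of_measure_eq b2 (by simp),
      toReal_klDiv_of_measure_eq hqν (by simp), integral_congr_ae e,
      integral_add j3 (integrable_const _),
      integral_add (j1.const_mul _) (j2.const_mul _), integral_const_mul, integral_const_mul]
    simp

lemma lintegral_euclSq_smul_add_lt_top {D : ℕ} {μ ν : Measure (Fin D → ℝ)} {c d : ℝ≥0∞}
    (hc : c ≠ ∞) (hd : d ≠ ∞)
    (hμ : ∫⁻ θ, ENNReal.ofReal (euclSq θ) ∂μ < ∞) (hν : ∫⁻ θ, ENNReal.ofReal (euclSq θ) ∂ν < ∞) :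
    ∫⁻ θ, ENNReal.ofReal (euclSq θ) ∂(c • μ + d • ν) < ∞ := by
  rw [lintegral_add_measure, lintegral_smul_measure, lintegral_smul_measure]
  exact ENNReal.add_lt_top.2 ⟨ENNReal.mul_lt_top hc.lt_top hμ, ENNReal.mul_lt_top hd.lt_top hν⟩

/-- A `Ξ`-variational posterior `q` with finite objective `F` is the normalized geometric mean
of the exact posterior and the product `m` of its own marginals. Indeed `q` also minimizes
`KL(· ‖ q₀) + λ KL(· ‖ m)`, which dominates the objective and agrees with it at `q`. -/
lemma xiPosterior_eq_withDensity {D : ℕ} {Θ : Fin D → Set ℝ} {q₀ q : Measure (Fin D → ℝ)}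
    (h₀ : q₀ ∈ probMeasures2 Θ) {n : Fin D → Measure ℝ} [∀ i, IsProbabilityMeasure (n i)]
    (hac₁ : q₀ ≪ Measure.pi n) (hac₂ : Measure.pi n ≪ q₀) {lam : ℝ} (hlam : 0 < lam)
    (hq : q ∈ xiPosteriors Θ q₀ (ENNReal.ofReal lam))
    (hF : xiObjective q₀ (ENNReal.ofReal lam) q ≠ ∞) :
    Measure.pi (marginals q) ≪ q₀ ∧
    q = q₀.withDensity (fun θ => ENNReal.ofReal
      (((Measure.pi (marginals q)).rnDeriv q₀ θ).toReal ^ (lam / (1 + lam)) *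
        Real.exp ((xiObjective q₀ (ENNReal.ofReal lam) q).toReal / (1 + lam)))) := by
  have := h₀.1.1
  have hqprob : IsProbabilityMeasure q := hq.1.1.1
  have hlam' : ENNReal.ofReal lam ≠ 0 := (ENNReal.ofReal_pos.2 hlam).ne'
  obtain ⟨hk0, hk1⟩ := ENNReal.add_ne_top.1 hF
  have hkm : klDiv q (Measure.pi (marginals q)) ≠ ∞ := fun h => hk1 (by
    rw [expressivity, h, ENNReal.mul_top hlam'])
  set m := Measure.pi (marginals q) with hm
  have hmq₀ : m ≪ q₀ := by
    refine Measure.AbsolutelyContinuous.trans (pi_absolutelyContinuous fun i => ?_) hac₂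
    have h1 := marginals_absolutelyContinuous ((klDiv_ne_top_iff.1 hk0).1.trans hac₁) i
    rwa [marginals_pi] at h1
  refine ⟨hmq₀, ?_⟩
  have h1lam : (0 : ℝ) < 1 + lam := by linarith
  obtain ⟨Z, ν, hZ, hν, hνprob, hνle, hν0, hνm, hid⟩ :=
    exists_geometricMean hmq₀ (a := lam / (1 + lam)) (by positivity)
      (by rw [div_lt_one h1lam]; linarith)
  have hνmem : ν ∈ probMeasures2 Θ := by
    refine ⟨mem_probMeasures_of_absolutelyContinuous h₀.1 (klDiv_ne_top_iff.1 hν0).1, ?_⟩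
    refine (lintegral_mono' hνle le_rfl).trans_lt ?_
    rw [smul_add]
    refine lintegral_euclSq_smul_add_lt_top ENNReal.ofReal_ne_top ENNReal.ofReal_ne_top h₀.2 ?_
    rw [hm, lintegral_euclSq_pi_marginals]
    exact hq.1.2
  -- the surrogate functional is `(1 + λ) KL(· ‖ ν)` up to a constant, so its minimizer is `ν`
  have key : ∀ r : Measure (Fin D → ℝ), IsProbabilityMeasure r → klDiv r q₀ ≠ ∞ → klDiv r m ≠ ∞ →
      (klDiv r q₀ + ENNReal.ofReal lam * klDiv r m).toReal
        = (1 + lam) * ((klDiv r ν).toReal - Real.log Z) := by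
    intro r hr h1 h2
    rw [← (hid r hr h1 h2).2, ENNReal.toReal_add h1 (ENNReal.mul_ne_top ENNReal.ofReal_ne_top h2),
      ENNReal.toReal_mul, ENNReal.toReal_ofReal hlam.le]
    field_simp
    ring
  have hJν : klDiv ν q₀ + ENNReal.ofReal lam * klDiv ν m ≠ ∞ :=
    ENNReal.add_ne_top.2 ⟨hν0, ENNReal.mul_ne_top ENNReal.ofReal_ne_top hνm⟩
  have hle : xiObjective q₀ (ENNReal.ofReal lam) q
      ≤ klDiv ν q₀ + ENNReal.ofReal lam * klDiv ν m := by
    refine (hq.2 ν hνmem).trans ?_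
    unfold xiObjective expressivity
    gcongr
    exact klDiv_pi_marginals_le ν _
  have hle' := ENNReal.toReal_mono hJν hle
  rw [key ν hνprob hν0 hνm, klDiv_self] at hle'
  have hFq : (xiObjective q₀ (ENNReal.ofReal lam) q).toReal
      = (1 + lam) * ((klDiv q ν).toReal - Real.log Z) := key q hqprob hk0 hkm
  have hzero : (klDiv q ν).toReal = 0 := by
    rw [hFq, ENNReal.toReal_zero] at hle'
    have := le_of_mul_le_mul_left hle' h1lam
    linarith [ENNReal.toReal_nonneg (a := klDiv q ν)]
  have hqν : q = ν := by
    have hntop : klDiv q ν ≠ ∞ := (hid q hqprob hk0 hkm).1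
    exact klDiv_eq_zero_iff.1 ((ENNReal.toReal_eq_zero_iff _).1 hzero |>.resolve_right hntop)
  have hexp : Real.exp ((xiObjective q₀ (ENNReal.ofReal lam) q).toReal / (1 + lam)) = Z⁻¹ := by
    rw [hFq, hzero, mul_div_cancel_left₀ _ h1lam.ne', zero_sub, Real.exp_neg, Real.exp_log hZ]
  rw [hexp]
  conv_lhs => rw [hqν, hν]
  rfl

/-! ### Domination of variational posteriors and entropic optimality -/

lemma withDensity_ofReal_toReal_rnDeriv {α : Type*} [MeasurableSpace α] {μ ν : Measure α}
    [IsFiniteMeasure μ] [IsFiniteMeasure ν] (h : μ ≪ ν) :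
    ν.withDensity (fun x => ENNReal.ofReal (μ.rnDeriv ν x).toReal) = μ := by
  conv_rhs => rw [← Measure.withDensity_rnDeriv_eq μ ν h]
  refine withDensity_congr_ae ?_
  filter_upwards [Measure.rnDeriv_lt_top μ ν] with x hx
  exact ENNReal.ofReal_toReal hx.ne

/-- The weighted arithmetic-geometric mean inequality, applied to the geometric mean `q`. -/
lemma xiPosterior_smul_le {D : ℕ} {Θ : Fin D → Set ℝ} {q₀ q : Measure (Fin D → ℝ)}
    (h₀ : q₀ ∈ probMeasures2 Θ) {n : Fin D → Measure ℝ} [∀ i, IsProbabilityMeasure (n i)]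
    (hac₁ : q₀ ≪ Measure.pi n) (hac₂ : Measure.pi n ≪ q₀) {lam : ℝ} (hlam : 0 < lam)
    (hq : q ∈ xiPosteriors Θ q₀ (ENNReal.ofReal lam))
    (hF : xiObjective q₀ (ENNReal.ofReal lam) q ≠ ∞) :
    ENNReal.ofReal (1 + lam) • q
      ≤ ENNReal.ofReal (Real.exp (xiObjective q₀ (ENNReal.ofReal lam) q).toReal) • q₀
        + ENNReal.ofReal lam • Measure.pi (marginals q) := by
  have := h₀.1.1
  have hqprob : IsProbabilityMeasure q := hq.1.1.1
  obtain ⟨hac, heq⟩ := xiPosterior_eq_withDensity h₀ hac₁ hac₂ hlam hq hF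
  set F := (xiObjective q₀ (ENNReal.ofReal lam) q).toReal
  set m := Measure.pi (marginals q)
  have hρm : Measurable fun θ => (m.rnDeriv q₀ θ).toReal :=
    (Measure.measurable_rnDeriv m q₀).ennreal_toReal
  have h1 : (0 : ℝ) < 1 + lam := by linarith
  have e1 : ENNReal.ofReal (1 + lam) • q = q₀.withDensity (fun θ => ENNReal.ofReal
      ((1 + lam) * ((m.rnDeriv q₀ θ).toReal ^ (lam / (1 + lam)) * Real.exp (F / (1 + lam))))) := by
    conv_lhs => rw [heq]
    rw [← withDensity_smul _ (by fun_prop)]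
    congr 1
    ext θ
    rw [Pi.smul_apply, smul_eq_mul, ENNReal.ofReal_mul h1.le]
  have e2 : ENNReal.ofReal (Real.exp F) • q₀ + ENNReal.ofReal lam • m
      = q₀.withDensity (fun θ => ENNReal.ofReal
        (Real.exp F + lam * (m.rnDeriv q₀ θ).toReal)) := by
    conv_lhs => rw [← withDensity_ofReal_toReal_rnDeriv hac, ← withDensity_const]
    rw [← withDensity_smul _ hρm.ennreal_ofReal, ← withDensity_add_left measurable_const]
    congr 1
    ext θ
    rw [ENNReal.ofReal_add (Real.exp_pos _).le (mul_nonneg hlam.le ENNReal.toReal_nonneg),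
      ENNReal.ofReal_mul hlam.le]
    rfl
  rw [e1, e2]
  refine withDensity_mono (ae_of_all _ fun θ => ENNReal.ofReal_le_ofReal ?_)
  have hr : 0 ≤ (m.rnDeriv q₀ θ).toReal := ENNReal.toReal_nonneg
  have amgm := Real.geom_mean_le_arith_mean2_weighted (w₁ := lam / (1 + lam))
    (w₂ := 1 / (1 + lam)) (by positivity) (by positivity) hr (Real.exp_pos F).le
    (by field_simp; ring)
  rw [← Real.exp_mul, mul_one_div] at amgm
  calc _ ≤ (1 + lam) * (lam / (1 + lam) * (m.rnDeriv q₀ θ).toReal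
        + 1 / (1 + lam) * Real.exp F) := mul_le_mul_of_nonneg_left amgm h1.le
    _ = _ := by field_simp; ring

/-- The marginals of a `Ξ`-variational posterior are dominated by those of the exact posterior,
with a factor that depends on the value of the objective only. -/
lemma marginals_xiPosterior_le {D : ℕ} {Θ : Fin D → Set ℝ} {q₀ q : Measure (Fin D → ℝ)}
    (h₀ : q₀ ∈ probMeasures2 Θ) {n : Fin D → Measure ℝ} [∀ i, IsProbabilityMeasure (n i)]
    (hac₁ : q₀ ≪ Measure.pi n) (hac₂ : Measure.pi n ≪ q₀) {lam : ℝ} (hlam : 0 < lam)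
    (hq : q ∈ xiPosteriors Θ q₀ (ENNReal.ofReal lam))
    (hF : xiObjective q₀ (ENNReal.ofReal lam) q ≠ ∞) (i : Fin D) :
    marginals q i
      ≤ ENNReal.ofReal (Real.exp (xiObjective q₀ (ENNReal.ofReal lam) q).toReal)
        • marginals q₀ i := by
  have hqprob : IsProbabilityMeasure q := hq.1.1.1
  refine Measure.le_iff.2 fun A hA => ?_
  have h1 := xiPosterior_smul_le h₀ hac₁ hac₂ hlam hq hF ((fun θ => θ i) ⁻¹' A)
  have h2 : Measure.pi (marginals q) ((fun θ => θ i) ⁻¹' A) = q ((fun θ => θ i) ⁻¹' A) := by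
    rw [← marginals_apply _ i hA, ← marginals_apply _ i hA, marginals_pi]
  rw [Measure.add_apply, Measure.smul_apply, Measure.smul_apply, Measure.smul_apply, h2,
    smul_eq_mul, smul_eq_mul, smul_eq_mul, ENNReal.ofReal_add zero_le_one hlam.le, add_mul,
    ENNReal.ofReal_one, one_mul] at h1
  rw [Measure.smul_apply, smul_eq_mul, marginals_apply _ i hA, marginals_apply _ i hA]
  exact (ENNReal.add_le_add_iff_right
    (ENNReal.mul_ne_top ENNReal.ofReal_ne_top (measure_ne_top _ _))).1 h1

/-- A finite measure with a finite second moment that dominates all `Ξ`-variational posteriors with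
objective at most `K`, see `xiPosterior_le_dominating`. -/
noncomputable def dominatingMeasure {D : ℕ} (q₀ : Measure (Fin D → ℝ)) (K : ℝ) :
    Measure (Fin D → ℝ) :=
  ENNReal.ofReal (Real.exp K) • q₀
    + ENNReal.ofReal (Real.exp K) ^ D • Measure.pi (marginals q₀)

lemma isFiniteMeasure_dominatingMeasure {D : ℕ} (q₀ : Measure (Fin D → ℝ))
    [IsProbabilityMeasure q₀] (K : ℝ) : IsFiniteMeasure (dominatingMeasure q₀ K) := by
  refine ⟨?_⟩
  simp only [dominatingMeasure, Measure.add_apply, Measure.smul_apply, measure_univ, smul_eq_mul,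
    mul_one]
  finiteness

lemma lintegral_euclSq_dominatingMeasure_lt_top {D : ℕ} {q₀ : Measure (Fin D → ℝ)}
    [IsProbabilityMeasure q₀] (h : ∫⁻ θ, ENNReal.ofReal (euclSq θ) ∂q₀ < ∞) (K : ℝ) :
    ∫⁻ θ, ENNReal.ofReal (euclSq θ) ∂(dominatingMeasure q₀ K) < ∞ :=
  lintegral_euclSq_smul_add_lt_top ENNReal.ofReal_ne_top (by finiteness) h
    (by rwa [lintegral_euclSq_pi_marginals])

lemma xiPosterior_le_dominating {D : ℕ} {Θ : Fin D → Set ℝ} {q₀ q : Measure (Fin D → ℝ)}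
    (h₀ : q₀ ∈ probMeasures2 Θ) {n : Fin D → Measure ℝ} [∀ i, IsProbabilityMeasure (n i)]
    (hac₁ : q₀ ≪ Measure.pi n) (hac₂ : Measure.pi n ≪ q₀) {lam : ℝ} (hlam : 0 < lam)
    (hq : q ∈ xiPosteriors Θ q₀ (ENNReal.ofReal lam)) {K : ℝ}
    (hF : xiObjective q₀ (ENNReal.ofReal lam) q ≤ ENNReal.ofReal K) (hK : 0 ≤ K) :
    q ≤ dominatingMeasure q₀ K := by
  have := h₀.1.1
  have hqprob : IsProbabilityMeasure q := hq.1.1.1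
  have hFtop : xiObjective q₀ (ENNReal.ofReal lam) q ≠ ∞ :=
    ne_top_of_le_ne_top ENNReal.ofReal_ne_top hF
  have hFK : ENNReal.ofReal (Real.exp (xiObjective q₀ (ENNReal.ofReal lam) q).toReal)
      ≤ ENNReal.ofReal (Real.exp K) :=
    ENNReal.ofReal_le_ofReal (Real.exp_le_exp.2 (ENNReal.toReal_le_of_le_ofReal hK hF))
  have hm : Measure.pi (marginals q)
      ≤ ENNReal.ofReal (Real.exp K) ^ D • Measure.pi (marginals q₀) := by
    refine pi_le_smul_pi fun i => Measure.le_iff.2 fun A hA => ?_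
    refine (marginals_xiPosterior_le h₀ hac₁ hac₂ hlam hq hFtop i A).trans ?_
    simp only [Measure.smul_apply, smul_eq_mul]
    gcongr
  refine Measure.le_iff.2 fun A hA => ?_
  have h1 := xiPosterior_smul_le h₀ hac₁ hac₂ hlam hq hFtop A
  simp only [Measure.add_apply, Measure.smul_apply, smul_eq_mul] at h1
  have hmA := hm A
  simp only [Measure.smul_apply, smul_eq_mul] at hmA
  simp only [dominatingMeasure, Measure.add_apply, Measure.smul_apply, smul_eq_mul]
  set M := Measure.pi (marginals q) A
  set c := ENNReal.ofReal (1 + lam) with hc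
  have hc1 : 1 ≤ c := by rw [hc, ← ENNReal.ofReal_one]; exact ENNReal.ofReal_le_ofReal (by linarith)
  have hcl : ENNReal.ofReal lam ≤ c := ENNReal.ofReal_le_ofReal (by linarith)
  have hc0 : c ≠ 0 := (zero_lt_one.trans_le hc1).ne'
  have h2 : c * q A ≤ c * (ENNReal.ofReal (Real.exp K) * q₀ A + M) := by
    rw [mul_add]
    refine h1.trans (add_le_add ?_ (mul_le_mul_left hcl M))
    exact (mul_le_mul_left hFK _).trans (le_mul_of_one_le_left zero_le hc1)
  refine ((ENNReal.mul_le_mul_iff_right hc0 ENNReal.ofReal_ne_top).1 h2).trans ?_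
  gcongr

/-- Optimality of an entropic coupling from its exponential form. If `dq/dm = exp X` for the product
`m` of the marginals of `q`, and `κ X` differs from an integrable `g` by a separable function, then
the separable function has integrable summands, and `q` maximizes `∫ g - κ KL(· ‖ m)` among all
couplings of its marginals. -/
lemma entropic_optimality {D : ℕ} {q : Measure (Fin D → ℝ)} [IsProbabilityMeasure q]
    {X g : (Fin D → ℝ) → ℝ} (hX : Measurable X)
    (hq : q = (Measure.pi (marginals q)).withDensity fun θ => ENNReal.ofReal (Real.exp (X θ)))
    (hkl : klDiv q (Measure.pi (marginals q)) ≠ ∞)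
    (hgq : Integrable g q) (hgm : Integrable g (Measure.pi (marginals q)))
    {ψ : Fin D → ℝ → ℝ} (hψ : ∀ i, Measurable (ψ i)) {κ c : ℝ} (hκ : 0 < κ)
    (hXg : ∀ᵐ θ ∂(Measure.pi (marginals q)), κ * X θ = g θ + ∑ i, ψ i (θ i) + c) :
    (∀ i, Integrable (ψ i) (marginals q i)) ∧
    ∀ r : Measure (Fin D → ℝ), IsProbabilityMeasure r → marginals r = marginals q →
      klDiv r (Measure.pi (marginals q)) ≠ ∞ → Integrable g r →
      κ * (klDiv q (Measure.pi (marginals q))).toReal - ∫ θ, g θ ∂q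
        ≤ κ * (klDiv r (Measure.pi (marginals q))).toReal - ∫ θ, g θ ∂r := by
  obtain ⟨hac, hint⟩ := klDiv_ne_top_iff.1 hkl
  set m := Measure.pi (marginals q) with hm
  have hexp : ∫⁻ θ, ENNReal.ofReal (Real.exp (X θ)) ∂m = 1 := by
    have := congrArg (fun μ => μ Set.univ) hq
    simp only [measure_univ, withDensity_apply _ MeasurableSet.univ, setLIntegral_univ] at this
    exact this.symm
  have hexpi : Integrable (fun θ => Real.exp (X θ)) m := by
    refine ⟨hX.exp.aestronglyMeasurable, ?_⟩
    rw [hasFiniteIntegral_iff_ofReal (ae_of_all _ fun θ => (Real.exp_pos (X θ)).le), hexp]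
    exact ENNReal.one_lt_top
  have hexp1 : ∫ θ, Real.exp (X θ) ∂m = 1 := by
    rw [integral_eq_lintegral_of_nonneg_ae (ae_of_all _ fun θ => (Real.exp_pos (X θ)).le)
      hX.exp.aestronglyMeasurable, hexp, ENNReal.toReal_one]
  have hllr : ∀ᵐ θ ∂m, llr q m θ = X θ := by
    have := m.rnDeriv_withDensity hX.exp.ennreal_ofReal
    rw [← hq] at this
    filter_upwards [this] with θ hθ
    rw [llr, hθ, ENNReal.toReal_ofReal (Real.exp_pos _).le, Real.log_exp]
  have hXq : Integrable X q := hint.congr (hac.ae_le hllr)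
  have hψq : Integrable (fun θ => ∑ i, ψ i (θ i)) q := by
    refine (((hXq.const_mul κ).sub hgq).sub (integrable_const c)).congr ?_
    filter_upwards [hac.ae_le hXg] with θ hθ
    simp only [Pi.sub_apply, hθ]; ring
  -- under the product measure, `κ X ≤ κ exp X` bounds the separable part from above
  have hψi : ∀ i, Integrable (ψ i) (marginals q i) := by
    refine integrable_of_integrable_sum hψ
      (((hexpi.const_mul κ).sub hgm).sub (integrable_const c)) ?_ rfl hψq
    filter_upwards [hXg] with θ hθ
    simp only [Pi.sub_apply]
    nlinarith [Real.add_one_le_exp (X θ)]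
  refine ⟨hψi, fun r hr hrq hklr hgr => ?_⟩
  have hformula : ∀ s : Measure (Fin D → ℝ), IsProbabilityMeasure s → marginals s = marginals q →
      s ≪ m → Integrable g s → Integrable X s ∧
      κ * ∫ θ, X θ ∂s = ∫ θ, g θ ∂s + ∑ i, ∫ x, ψ i x ∂(marginals q i) + c := by
    intro s hs hsq hsm hgs
    have hψs : ∀ i, Integrable (fun θ : Fin D → ℝ => ψ i (θ i)) s := fun i =>
      (integrable_eval_iff (hψ i)).2 (by rw [hsq]; exact hψi i)
    have hsum : Integrable (fun θ : Fin D → ℝ => ∑ i, ψ i (θ i)) s :=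
      integrable_finsetSum _ fun i _ => hψs i
    have hgψ : Integrable (fun θ : Fin D → ℝ => g θ + ∑ i, ψ i (θ i)) s := hgs.add hsum
    have e : ∀ᵐ θ ∂s, κ * X θ = g θ + ∑ i, ψ i (θ i) + c := hsm.ae_le hXg
    have hκX : Integrable (fun θ => κ * X θ) s :=
      (hgψ.add (integrable_const c)).congr (e.mono fun _ h => h.symm)
    refine ⟨?_, ?_⟩
    · refine (hκX.const_mul κ⁻¹).congr (ae_of_all _ fun θ => ?_)
      simp only; rw [inv_mul_cancel_left₀ hκ.ne']
    · rw [← integral_const_mul, integral_congr_ae e, integral_add hgψ (integrable_const c),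
        integral_add hgs hsum, integral_finsetSum _ fun i _ => hψs i]
      simp only [integral_eval (hψ _), hsq]
      simp
  -- the Donsker–Varadhan inequality for `X`, which is an equality at `q`
  obtain ⟨-, hq2⟩ := hformula q inferInstance rfl hac hgq
  obtain ⟨hr1, hr2⟩ := hformula r hr hrq (klDiv_ne_top_iff.1 hklr).1 hgr
  have hklq : (klDiv q m).toReal = ∫ θ, X θ ∂q := by
    rw [toReal_klDiv_of_measure_eq hac (by simp [hm])]
    exact integral_congr_ae (hac.ae_le hllr)
  have hdv := integral_le_toReal_klDiv_add hklr hr1 hexpi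
  rw [hexp1, sub_self, add_zero] at hdv
  have := mul_le_mul_of_nonneg_left hdv hκ.le
  rw [hklq]
  linarith

/-! ### The exact posterior and optimality of variational posteriors -/

lemma isProbabilityMeasure_posterior {D : ℕ} {prior : Fin D → Measure ℝ}
    [∀ i, IsProbabilityMeasure (prior i)] {ℓ : (Fin D → ℝ) → ℝ}
    (hZ : Integrable (fun θ => Real.exp (ℓ θ)) (Measure.pi prior)) :
    IsProbabilityMeasure (posterior prior ℓ) :=
  isProbabilityMeasure_tilted hZ

lemma posterior_absolutelyContinuous {D : ℕ} (prior : Fin D → Measure ℝ)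
    (ℓ : (Fin D → ℝ) → ℝ) : posterior prior ℓ ≪ Measure.pi prior :=
  tilted_absolutelyContinuous _ _

lemma absolutelyContinuous_posterior {D : ℕ} {prior : Fin D → Measure ℝ} {ℓ : (Fin D → ℝ) → ℝ}
    (hZ : Integrable (fun θ => Real.exp (ℓ θ)) (Measure.pi prior)) :
    Measure.pi prior ≪ posterior prior ℓ :=
  absolutelyContinuous_tilted hZ

/-- If `q₀` is equivalent to a product measure, then `q ≪ q₀` passes to the product of the marginals
of `q`. -/
lemma pi_marginals_absolutelyContinuous {D : ℕ} {q₀ q : Measure (Fin D → ℝ)}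
    [IsProbabilityMeasure q] {n : Fin D → Measure ℝ} [∀ i, IsProbabilityMeasure (n i)]
    (hac₁ : q₀ ≪ Measure.pi n) (hac₂ : Measure.pi n ≪ q₀) (hq : q ≪ q₀) :
    Measure.pi (marginals q) ≪ q₀ := by
  refine Measure.AbsolutelyContinuous.trans (pi_absolutelyContinuous fun i => ?_) hac₂
  have h1 := marginals_absolutelyContinuous (hq.trans hac₁) i
  rwa [marginals_pi] at h1

lemma marginals_absolutelyContinuous_prior {D : ℕ} {q : Measure (Fin D → ℝ)}
    {n : Fin D → Measure ℝ} [∀ i, IsProbabilityMeasure (n i)] (hq : q ≪ Measure.pi n)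
    (i : Fin D) : marginals q i ≪ n i := by
  have h1 := marginals_absolutelyContinuous hq i
  rwa [marginals_pi] at h1

lemma llr_posterior {D : ℕ} {prior : Fin D → Measure ℝ}
    [∀ i, IsProbabilityMeasure (prior i)] {ℓ : (Fin D → ℝ) → ℝ}
    (hZ : Integrable (fun θ => Real.exp (ℓ θ)) (Measure.pi prior)) :
    ∀ᵐ θ ∂(Measure.pi prior), llr (posterior prior ℓ) (Measure.pi prior) θ
      = ℓ θ - Real.log (∫ θ, Real.exp (ℓ θ) ∂(Measure.pi prior)) :=
  log_rnDeriv_tilted_left_self hZ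

/-- Up to the log-likelihood and a constant, the log-density of a product measure with respect to
the posterior is separable. -/
lemma llr_pi_posterior {D : ℕ} {prior : Fin D → Measure ℝ}
    [∀ i, IsProbabilityMeasure (prior i)] {ℓ : (Fin D → ℝ) → ℝ}
    (hZ : Integrable (fun θ => Real.exp (ℓ θ)) (Measure.pi prior)) {m : Fin D → Measure ℝ}
    [∀ i, IsProbabilityMeasure (m i)] (hm : ∀ i, m i ≪ prior i) :
    ∀ᵐ θ ∂(Measure.pi m), llr (Measure.pi m) (posterior prior ℓ) θ
      = ∑ i, llr (m i) (prior i) (θ i) - ℓ θ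
        + Real.log (∫ θ, Real.exp (ℓ θ) ∂(Measure.pi prior)) := by
  have := isProbabilityMeasure_posterior hZ
  have h1 := pi_absolutelyContinuous hm
  filter_upwards [llr_add_llr (h1.trans (absolutelyContinuous_posterior hZ))
    (posterior_absolutelyContinuous prior ℓ), llr_pi hm, h1.ae_le (llr_posterior hZ)]
    with θ e1 e2 e3
  rw [e2, e3] at e1
  linarith

/-- The exponential form of a `Ξ`-variational posterior with respect to the product of its
marginals. -/
lemma xiPosterior_eq_withDensity_exp {D : ℕ} {Θ : Fin D → Set ℝ} {q₀ q : Measure (Fin D → ℝ)}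
    (h₀ : q₀ ∈ probMeasures2 Θ) {n : Fin D → Measure ℝ} [∀ i, IsProbabilityMeasure (n i)]
    (hac₁ : q₀ ≪ Measure.pi n) (hac₂ : Measure.pi n ≪ q₀) {lam : ℝ} (hlam : 0 < lam)
    (hq : q ∈ xiPosteriors Θ q₀ (ENNReal.ofReal lam))
    (hF : xiObjective q₀ (ENNReal.ofReal lam) q ≠ ∞) :
    q = (Measure.pi (marginals q)).withDensity (fun θ => ENNReal.ofReal (Real.exp
      (((xiObjective q₀ (ENNReal.ofReal lam) q).toReal
        - llr (Measure.pi (marginals q)) q₀ θ) / (1 + lam)))) := by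
  have := h₀.1.1
  have hqprob : IsProbabilityMeasure q := hq.1.1.1
  obtain ⟨hac, heq⟩ := xiPosterior_eq_withDensity h₀ hac₁ hac₂ hlam hq hF
  set F := (xiObjective q₀ (ENNReal.ofReal lam) q).toReal
  set m := Measure.pi (marginals q)
  have hρm : Measurable fun θ => (m.rnDeriv q₀ θ).toReal :=
    (Measure.measurable_rnDeriv m q₀).ennreal_toReal
  have hXm : Measurable fun θ => Real.exp ((F - llr m q₀ θ) / (1 + lam)) :=
    (((measurable_llr m q₀).const_sub F).div_const _).exp
  have h1 : (0 : ℝ) < 1 + lam := by linarith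
  have hm := withDensity_mul q₀ hρm.ennreal_ofReal hXm.ennreal_ofReal
  rw [withDensity_ofReal_toReal_rnDeriv hac] at hm
  refine heq.trans (Eq.trans ?_ hm)
  congr 1
  ext θ
  rw [Pi.mul_apply, ← ENNReal.ofReal_mul ENNReal.toReal_nonneg]
  congr 1
  simp only [llr]
  rcases (ENNReal.toReal_nonneg (a := m.rnDeriv q₀ θ)).eq_or_lt with h0 | hpos
  · rw [← h0, Real.zero_rpow (by positivity)]; simp
  · rw [Real.rpow_def_of_pos hpos]
    conv_rhs => rw [← Real.exp_log hpos, Real.log_exp]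
    rw [← Real.exp_add, ← Real.exp_add]
    congr 1
    field_simp
    ring

/-- A `Ξ`-variational posterior minimizes the entropic transport objective with cost `-g` among all
couplings of its own marginals, where `g` is any integrable function that differs from `ℓ` by a
separable function. -/
lemma xiPosterior_optimal {D : ℕ} {Θ : Fin D → Set ℝ} {prior : Fin D → Measure ℝ}
    [∀ i, IsProbabilityMeasure (prior i)] {ℓ : (Fin D → ℝ) → ℝ}
    (hZ : Integrable (fun θ => Real.exp (ℓ θ)) (Measure.pi prior))
    (hpost : posterior prior ℓ ∈ probMeasures2 Θ) {lam : ℝ} (hlam : 0 < lam)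
    {q : Measure (Fin D → ℝ)}
    (hq : q ∈ xiPosteriors Θ (posterior prior ℓ) (ENNReal.ofReal lam))
    (hF : xiObjective (posterior prior ℓ) (ENNReal.ofReal lam) q ≠ ∞)
    {φ : Fin D → ℝ → ℝ} (hφ : ∀ i, Measurable (φ i))
    (hgq : Integrable (fun θ => ℓ θ - ∑ i, φ i (θ i)) q)
    (hgm : Integrable (fun θ => ℓ θ - ∑ i, φ i (θ i)) (Measure.pi (marginals q)))
    {r : Measure (Fin D → ℝ)} (hr : IsProbabilityMeasure r) (hrq : marginals r = marginals q)
    (hkl : klDiv r (Measure.pi (marginals q)) ≠ ∞)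
    (hgr : Integrable (fun θ => ℓ θ - ∑ i, φ i (θ i)) r) :
    (1 + lam) * (klDiv q (Measure.pi (marginals q))).toReal
        - ∫ θ, (ℓ θ - ∑ i, φ i (θ i)) ∂q
      ≤ (1 + lam) * (klDiv r (Measure.pi (marginals q))).toReal
        - ∫ θ, (ℓ θ - ∑ i, φ i (θ i)) ∂r := by
  have := isProbabilityMeasure_posterior hZ
  have hqprob : IsProbabilityMeasure q := hq.1.1.1
  have hac₁ := posterior_absolutelyContinuous prior ℓ
  have hac₂ := absolutelyContinuous_posterior hZ
  have hqac : q ≪ posterior prior ℓ := (klDiv_ne_top_iff.1 (ENNReal.add_ne_top.1 hF).1).1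
  have hmi := marginals_absolutelyContinuous_prior (hqac.trans hac₁)
  have hklq : klDiv q (Measure.pi (marginals q)) ≠ ∞ := fun h => (ENNReal.add_ne_top.1 hF).2 (by
    rw [expressivity, h, ENNReal.mul_top (ENNReal.ofReal_pos.2 hlam).ne'])
  have h1 : (0 : ℝ) < 1 + lam := by linarith
  refine (entropic_optimality (κ := 1 + lam)
    (c := (xiObjective (posterior prior ℓ) (ENNReal.ofReal lam) q).toReal
      - Real.log (∫ θ, Real.exp (ℓ θ) ∂(Measure.pi prior)))
    (ψ := fun i x => φ i x - llr (marginals q i) (prior i) x)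
    (((measurable_llr _ _).const_sub _).div_const _)
    (xiPosterior_eq_withDensity_exp hpost hac₁ hac₂ hlam hq hF) hklq hgq hgm
    (fun i => (hφ i).sub (measurable_llr _ _)) h1 ?_).2 r hr hrq hkl hgr
  filter_upwards [llr_pi_posterior hZ hmi] with θ hθ
  rw [mul_div_cancel₀ _ h1.ne', hθ, Finset.sum_sub_distrib]
  ring

lemma klDiv_posterior_prior_ne_top {D : ℕ} {prior : Fin D → Measure ℝ}
    [∀ i, IsProbabilityMeasure (prior i)] {ℓ : (Fin D → ℝ) → ℝ}
    (hZ : Integrable (fun θ => Real.exp (ℓ θ)) (Measure.pi prior))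
    (hℓ : Integrable ℓ (posterior prior ℓ)) :
    klDiv (posterior prior ℓ) (Measure.pi prior) ≠ ∞ := by
  have := isProbabilityMeasure_posterior hZ
  have hac := posterior_absolutelyContinuous prior ℓ
  refine klDiv_ne_top hac ((hℓ.sub (integrable_const
    (Real.log (∫ θ, Real.exp (ℓ θ) ∂(Measure.pi prior))))).congr ?_)
  filter_upwards [hac.ae_le (llr_posterior hZ)] with θ hθ
  simp [hθ]

/-- If `ℓ` and `ℓ - ∑ φ i` are integrable under the posterior, and the latter also under the product
of the posterior marginals, then every `φ i` is integrable: the posterior itself has the exponential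
form of `entropic_optimality`, with `κ = 1`. -/
lemma integrable_of_posterior {D : ℕ} {prior : Fin D → Measure ℝ}
    [∀ i, IsProbabilityMeasure (prior i)] {ℓ : (Fin D → ℝ) → ℝ}
    (hZ : Integrable (fun θ => Real.exp (ℓ θ)) (Measure.pi prior))
    (hℓ : Integrable ℓ (posterior prior ℓ))
    {φ : Fin D → ℝ → ℝ} (hφ : ∀ i, Measurable (φ i))
    (hgq : Integrable (fun θ => ℓ θ - ∑ i, φ i (θ i)) (posterior prior ℓ))
    (hgm : Integrable (fun θ => ℓ θ - ∑ i, φ i (θ i))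
      (Measure.pi (marginals (posterior prior ℓ)))) (i : Fin D) :
    Integrable (φ i) (marginals (posterior prior ℓ) i) := by
  have := isProbabilityMeasure_posterior hZ
  have hac₁ := posterior_absolutelyContinuous prior ℓ
  have hac₂ := absolutelyContinuous_posterior hZ
  have hmi := marginals_absolutelyContinuous_prior hac₁
  set q₀ := posterior prior ℓ
  have hklπ : klDiv q₀ (Measure.pi prior) ≠ ∞ := klDiv_posterior_prior_ne_top hZ hℓ
  have hkl : klDiv q₀ (Measure.pi (marginals q₀)) ≠ ∞ :=
    ne_top_of_le_ne_top hklπ (klDiv_pi_marginals_le q₀ prior)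
  have hq₀m : q₀ ≪ Measure.pi (marginals q₀) := (klDiv_ne_top_iff.1 hkl).1
  have hmq₀ : Measure.pi (marginals q₀) ≪ q₀ :=
    pi_marginals_absolutelyContinuous hac₁ hac₂ Measure.AbsolutelyContinuous.rfl
  have hu : Integrable (llr (marginals q₀ i) (prior i)) (marginals q₀ i) := by
    have h1 : klDiv (marginals q₀ i) (prior i) ≤ klDiv q₀ (Measure.pi prior) := by
      have h2 := klDiv_map_le q₀ (Measure.pi prior)
        (measurable_pi_apply (X := fun _ : Fin D => ℝ) i)
      have h3 : (Measure.pi prior).map (fun θ : Fin D → ℝ => θ i) = prior i :=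
        congrFun (marginals_pi prior) i
      rwa [h3] at h2
    exact (klDiv_ne_top_iff.1 (ne_top_of_le_ne_top hklπ h1)).2
  have hform : q₀ = (Measure.pi (marginals q₀)).withDensity
      fun θ => ENNReal.ofReal (Real.exp (llr q₀ (Measure.pi (marginals q₀)) θ)) := by
    conv_lhs => rw [← withDensity_ofReal_toReal_rnDeriv hq₀m]
    refine withDensity_congr_ae ?_
    filter_upwards [exp_llr_of_ac' q₀ (Measure.pi (marginals q₀)) hmq₀] with θ hθ
    rw [hθ]
  have hψ := (entropic_optimality (κ := 1)
    (c := - Real.log (∫ θ, Real.exp (ℓ θ) ∂(Measure.pi prior)))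
    (ψ := fun i x => φ i x - llr (marginals q₀ i) (prior i) x)
    (measurable_llr _ _) hform hkl hgq hgm
    (fun i => (hφ i).sub (measurable_llr _ _)) one_pos (by
      filter_upwards [llr_pi_posterior hZ hmi, neg_llr hmq₀] with θ h1 h2
      rw [Pi.neg_apply] at h2
      rw [one_mul, ← h2, h1, Finset.sum_sub_distrib]
      ring)).1 i
  exact (hψ.add hu).congr (ae_of_all _ fun x => by simp)

/-! ### Shadows of couplings -/

/-- Shadows of couplings: a plan `γ` between `a` and `b` moves every measure `q` with the marginals
of `a` to a measure with the marginals of `b`, at no more than the cost of `γ` and without increase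
of the divergence from the product of the marginals. The coordinates are moved independently of
each other, by the conditional laws of the coordinate pairs of `γ`, which are realized as images of
independent uniform variables. -/
lemma exists_shadow {D : ℕ} {a b q : Measure (Fin D → ℝ)} [IsProbabilityMeasure a]
    [IsProbabilityMeasure q] (hq : marginals q = marginals a)
    {γ : Measure ((Fin D → ℝ) × (Fin D → ℝ))} (hγ : γ ∈ transportPlans a b) :
    ∃ r : Measure (Fin D → ℝ), IsProbabilityMeasure r ∧ marginals r = marginals b ∧
      transportCost q r ≤ ∫⁻ z, ENNReal.ofReal (euclSq (z.1 - z.2)) ∂γ ∧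
      klDiv r (Measure.pi (marginals b)) ≤ klDiv q (Measure.pi (marginals a)) := by
  have hγprob : IsProbabilityMeasure γ := by
    have : IsProbabilityMeasure (γ.map Prod.fst) := by rw [hγ.1]; infer_instance
    exact Measure.isProbabilityMeasure_of_map Prod.fst
  have hpm : ∀ i : Fin D, Measurable fun z : (Fin D → ℝ) × (Fin D → ℝ) => (z.1 i, z.2 i) :=
    fun i => by fun_prop
  let γi : Fin D → Measure (ℝ × ℝ) := fun i => γ.map fun z => (z.1 i, z.2 i)
  have hγi : ∀ i, IsProbabilityMeasure (γi i) := fun i =>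
    Measure.isProbabilityMeasure_map (hpm i).aemeasurable
  have hfst : ∀ i, (γi i).fst = marginals a i := fun i => by
    simp only [γi, marginals, Measure.fst]
    rw [Measure.map_map measurable_fst (hpm i), ← hγ.1,
      Measure.map_map (measurable_pi_apply i) measurable_fst]
    rfl
  have hsnd : ∀ i, (γi i).map Prod.snd = marginals b i := fun i => by
    simp only [γi, marginals]
    rw [Measure.map_map measurable_snd (hpm i), ← hγ.2,
      Measure.map_map (measurable_pi_apply i) measurable_snd]
    rfl
  choose f hf hfmap using fun i =>
    ProbabilityTheory.Kernel.exists_measurable_map_eq_unitInterval (γi i).condKernel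
  let vol : Measure unitInterval := volume
  have hfpair : ∀ i, Measurable fun w : ℝ × unitInterval => (w.1, f i w.1 w.2) := fun i =>
    measurable_fst.prodMk (hf i)
  have hcoord : ∀ i, ((marginals a i).prod vol).map (fun w => (w.1, f i w.1 w.2)) = γi i := by
    intro i
    ext A hA
    conv_rhs => rw [← (γi i).disintegrate (γi i).condKernel]
    rw [Measure.map_apply (hfpair i) hA, Measure.prod_apply ((hfpair i) hA),
      Measure.compProd_apply hA, hfst]
    refine lintegral_congr fun x => ?_
    have hfx : Measurable (f i x) := (hf i).comp measurable_prodMk_left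
    rw [← hfmap i x, Measure.map_apply hfx (measurable_prodMk_left hA)]
    rfl
  let U : Measure (Fin D → unitInterval) := Measure.pi fun _ => vol
  let G : (Fin D → ℝ) × (Fin D → unitInterval) → (Fin D → ℝ) := fun w i => f i (w.1 i) (w.2 i)
  have hG : Measurable G := measurable_pi_iff.2 fun i => by
    have h : Measurable fun w : (Fin D → ℝ) × (Fin D → unitInterval) => (w.1 i, w.2 i) := by
      fun_prop
    exact (hf i).comp h
  have hUi : ∀ i, U.map (fun u => u i) = vol := fun i => (measurePreserving_eval _ i).map_eq
  -- the law of the `i`-th old and new coordinate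
  have hlaw : ∀ i, (q.prod U).map (fun w => (w.1 i, G w i)) = γi i := by
    intro i
    rw [← hcoord i, ← hq, marginals, ← hUi i,
      Measure.map_prod_map _ _ (measurable_pi_apply i) (measurable_pi_apply i),
      Measure.map_map (hfpair i) (by fun_prop)]
    rfl
  refine ⟨(q.prod U).map G, Measure.isProbabilityMeasure_map hG.aemeasurable, ?_, ?_, ?_⟩
  · ext1 i
    rw [← hsnd i, ← hlaw i, Measure.map_map measurable_snd (by fun_prop), marginals,
      Measure.map_map (measurable_pi_apply i) hG]
    rfl
  · have hpair : Measurable fun w : (Fin D → ℝ) × (Fin D → unitInterval) => (w.1, G w) := by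
      fun_prop
    have hmem : (q.prod U).map (fun w => (w.1, G w)) ∈ transportPlans q ((q.prod U).map G) := by
      refine ⟨?_, ?_⟩
      · rw [Measure.map_map measurable_fst hpair]
        exact Measure.map_fst_prod.trans (by simp [U])
      · rw [Measure.map_map measurable_snd hpair]; rfl
    refine (transportCost_le hmem).trans_eq ?_
    rw [lintegral_map (by fun_prop) hpair]
    have hsum : ∀ v : Fin D → ℝ, ENNReal.ofReal (euclSq v) = ∑ i, ENNReal.ofReal (v i ^ 2) :=
      fun v => ENNReal.ofReal_sum_of_nonneg fun _ _ => sq_nonneg _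
    simp_rw [hsum]
    rw [lintegral_finsetSum _ fun i _ => by fun_prop, lintegral_finsetSum _ fun i _ => by fun_prop]
    refine Finset.sum_congr rfl fun i _ => ?_
    have hc : Measurable fun z : ℝ × ℝ => ENNReal.ofReal ((z.1 - z.2) ^ 2) := by fun_prop
    have e1 := lintegral_map (μ := q.prod U) hc
      (show Measurable fun w => (w.1 i, G w i) by fun_prop)
    have e2 := lintegral_map (μ := γ) hc (hpm i)
    rw [hlaw i] at e1
    exact e1.symm.trans e2
  · have hprod : ((Measure.pi (marginals a)).prod U).map G = Measure.pi (marginals b) := by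
      have e := (measurePreserving_arrowProdEquivProdArrow ℝ unitInterval (Fin D)
        (marginals a) fun _ => vol).map_eq
      rw [← e, Measure.map_map hG (MeasurableEquiv.measurable _)]
      have hgi : ∀ i, ((marginals a i).prod vol).map (fun w => f i w.1 w.2) = marginals b i := by
        intro i
        rw [← hsnd i, ← hcoord i, Measure.map_map measurable_snd (hfpair i)]
        rfl
      have hfi : ∀ i, Measurable fun w : ℝ × unitInterval => f i w.1 w.2 := fun i => hf i
      have : ∀ i, SigmaFinite (((marginals a i).prod vol).map (fun w => f i w.1 w.2)) := fun i =>
        have := Measure.isProbabilityMeasure_map (μ := (marginals a i).prod vol)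
          (hfi i).aemeasurable
        inferInstance
      have e2 := Measure.pi_map_pi (μ := fun i => (marginals a i).prod vol)
        (f := fun i w => f i w.1 w.2) fun i => (hfi i).aemeasurable
      simp_rw [hgi] at e2
      exact e2
    rw [← hprod]
    refine (klDiv_map_le _ _ hG).trans ?_
    rw [← Measure.compProd_const, ← Measure.compProd_const, klDiv_compProd_left]

/-! ### Stability of entropic optimal transport -/

lemma marginals_midpoint {D : ℕ} {q r : Measure (Fin D → ℝ)} (h : marginals q = marginals r) :
    marginals ((2⁻¹ : ℝ≥0∞) • (q + r)) = marginals r := by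
  ext1 i
  have hi := congrFun h i
  simp only [marginals] at hi ⊢
  rw [Measure.map_smul, Measure.map_add _ _ (measurable_pi_apply i), hi, ← two_smul ℝ≥0∞,
    smul_smul, ENNReal.inv_mul_cancel (by simp) (by simp), one_smul]

lemma integral_midpoint {α : Type*} [MeasurableSpace α] {q r : Measure α} {f : α → ℝ}
    (hq : Integrable f q) (hr : Integrable f r) :
    Integrable f ((2⁻¹ : ℝ≥0∞) • (q + r)) ∧
      2 * ∫ x, f x ∂((2⁻¹ : ℝ≥0∞) • (q + r)) = ∫ x, f x ∂q + ∫ x, f x ∂r := by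
  refine ⟨(hq.add_measure hr).smul_measure (by simp), ?_⟩
  rw [integral_smul_measure, integral_add_measure hq hr]
  simp

/-- Strong convexity of the entropic transport problem: the excess of the objective over its minimum
controls the divergences to the midpoint with the optimizer. -/
lemma eot_excess {D : ℕ} {Θ : Fin D → Set ℝ} {ℓ : (Fin D → ℝ) → ℝ} {lam : ℝ}
    {m : Fin D → Measure ℝ} [∀ i, IsProbabilityMeasure (m i)] {p r : Measure (Fin D → ℝ)}
    (hp : IsEOTOptimizer Θ ℓ lam m p) {φ : Fin D → ℝ → ℝ} (hφ : ∀ i, Measurable (φ i))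
    (hφi : ∀ i, Integrable (φ i) (m i))
    (hgp : Integrable (fun θ => ℓ θ - ∑ i, φ i (θ i)) p)
    (hr : r ∈ couplings Θ m) (hkl : klDiv r (Measure.pi m) ≠ ∞)
    (hgr : Integrable (fun θ => ℓ θ - ∑ i, φ i (θ i)) r) :
    (2⁻¹ : ℝ≥0∞) • (r + p) ∈ couplings Θ m ∧
    (lam + 1) * ((klDiv r ((2⁻¹ : ℝ≥0∞) • (r + p))).toReal
        + (klDiv p ((2⁻¹ : ℝ≥0∞) • (r + p))).toReal)
      ≤ ((lam + 1) * (klDiv r (Measure.pi m)).toReal - ∫ θ, (ℓ θ - ∑ i, φ i (θ i)) ∂r)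
        - ((lam + 1) * (klDiv p (Measure.pi m)).toReal - ∫ θ, (ℓ θ - ∑ i, φ i (θ i)) ∂p) := by
  obtain ⟨⟨hpc, hℓp, hklp⟩, hmin⟩ := hp
  have : IsProbabilityMeasure p := hpc.1.1
  have : IsProbabilityMeasure r := hr.1.1
  have hformula : ∀ s : Measure (Fin D → ℝ), marginals s = m →
      Integrable (fun θ => ℓ θ - ∑ i, φ i (θ i)) s →
      Integrable ℓ s ∧ ∫ θ, ℓ θ ∂s
        = ∫ θ, (ℓ θ - ∑ i, φ i (θ i)) ∂s + ∑ i, ∫ x, φ i x ∂(m i) := by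
    intro s hs hgs
    have hφs : ∀ i, Integrable (fun θ : Fin D → ℝ => φ i (θ i)) s := fun i =>
      (integrable_eval_iff (hφ i)).2 (by rw [hs]; exact hφi i)
    have hsum : Integrable (fun θ : Fin D → ℝ => ∑ i, φ i (θ i)) s :=
      integrable_finsetSum _ fun i _ => hφs i
    have hℓs : Integrable ℓ s := (hgs.add hsum).congr (ae_of_all _ fun θ => by simp)
    refine ⟨hℓs, ?_⟩
    rw [integral_sub hℓs hsum, integral_finsetSum _ fun i _ => hφs i]
    simp only [integral_eval (hφ _), hs]
    ring
  obtain ⟨-, hp2⟩ := hformula p hpc.2 hgp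
  obtain ⟨hℓr, hr2⟩ := hformula r hr.2 hgr
  obtain ⟨hmid1, hmid2⟩ := klDiv_midpoint hkl hklp
  obtain ⟨him1, him2⟩ := integral_midpoint hℓr hℓp
  set h := (2⁻¹ : ℝ≥0∞) • (r + p) with hh
  have hc : h ∈ couplings Θ m := by
    refine ⟨⟨isProbabilityMeasure_midpoint r p, ?_, ?_⟩, ?_⟩
    · exact Measure.smul_absolutelyContinuous.trans
        (Measure.AbsolutelyContinuous.add_left_iff.2 ⟨hr.1.2.1, hpc.1.2.1⟩)
    · rw [hh, Measure.smul_apply, Measure.add_apply, hr.1.2.2, hpc.1.2.2]; simp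
    · rw [hh, marginals_midpoint (hr.2.trans hpc.2.symm), hpc.2]
  refine ⟨hc, ?_⟩
  have hopt := hmin h ⟨hc, him1, hmid1⟩
  simp only [eotObjective, integral_neg] at hopt
  have e : (klDiv r h).toReal + (klDiv p h).toReal = (klDiv r (Measure.pi m)).toReal
      + (klDiv p (Measure.pi m)).toReal - 2 * (klDiv h (Measure.pi m)).toReal := by linarith
  rw [e]
  nlinarith

/-- The modulus of stability of `transportCost_eot_xiPosterior_le`: the squared distance between the
optimal coupling and a variational posterior, when the squared distance from the latter to a law
with the new marginals is less than `δ`. -/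
noncomputable def stabilityModulus (L C : ℝ≥0) (δ : ℝ≥0∞) : ℝ≥0∞ :=
  8 * (C ^ 2 * (2 * L * δ ^ (1 / 2 : ℝ)) ^ (1 / 2 : ℝ)) + 2 * δ

lemma tendsto_stabilityModulus (L C : ℝ≥0) :
    Tendsto (stabilityModulus L C) (𝓝 0) (𝓝 0) := by
  have h1 : Tendsto (fun δ : ℝ≥0∞ => δ ^ (1 / 2 : ℝ)) (𝓝 0) (𝓝 0) := by
    simpa using (ENNReal.continuous_rpow_const (y := (1 / 2 : ℝ))).tendsto 0
  have h2 : Tendsto (fun δ : ℝ≥0∞ => 2 * (L : ℝ≥0∞) * δ ^ (1 / 2 : ℝ)) (𝓝 0) (𝓝 0) := by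
    simpa using ENNReal.Tendsto.const_mul (a := 2 * (L : ℝ≥0∞)) h1 (Or.inr (by finiteness))
  have h3 := h1.comp h2
  have h4 := ENNReal.Tendsto.const_mul (a := (C : ℝ≥0∞) ^ 2) h3 (Or.inr (by finiteness))
  have h5 := ENNReal.Tendsto.const_mul (a := 8) h4 (Or.inr (by simp))
  have h6 : Tendsto (fun δ : ℝ≥0∞ => 2 * δ) (𝓝 0) (𝓝 (2 * 0)) :=
    ENNReal.Tendsto.const_mul tendsto_id (Or.inr (by simp))
  unfold stabilityModulus
  simpa [Function.comp_def] using h5.add h6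

lemma transportCost_le_of_transportInequality {D : ℕ} {Θ : Fin D → Set ℝ} {C : ℝ≥0}
    {m : Fin D → Measure ℝ} (hC : TransportInequality Θ C m) {q r : Measure (Fin D → ℝ)}
    (hq : q ∈ couplings Θ m) (hr : r ∈ couplings Θ m) :
    transportCost q r ≤ C ^ 2 * klDiv q r ^ (1 / 2 : ℝ) := by
  rw [transportCost_eq_sq]
  refine (pow_le_pow_left' (hC q hq r hr) 2).trans_eq ?_
  rw [mul_pow, ← ENNReal.rpow_natCast (klDiv q r ^ _), ← ENNReal.rpow_mul]
  norm_num

/-- Quantitative stability of entropic optimal transport under a change of the marginals. If `b` is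
close to the variational posterior `q`, then so is the optimal entropic coupling of the marginals
of `b`. The shadows of both optimizers show that the optimal values are close; strong convexity and
the transportation cost inequality turn this into closeness of the optimizer and the shadow. The
bound does not depend on `λ`. -/
lemma transportCost_eot_xiPosterior_le {D : ℕ} {Θ : Fin D → Set ℝ} {prior : Fin D → Measure ℝ}
    [∀ i, IsProbabilityMeasure (prior i)] {ℓ : (Fin D → ℝ) → ℝ}
    (hZ : Integrable (fun θ => Real.exp (ℓ θ)) (Measure.pi prior))
    (hpost : posterior prior ℓ ∈ probMeasures2 Θ) {lam : ℝ} (hlam : 0 < lam)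
    {q : Measure (Fin D → ℝ)}
    (hq : q ∈ xiPosteriors Θ (posterior prior ℓ) (ENNReal.ofReal lam))
    (hF : xiObjective (posterior prior ℓ) (ENNReal.ofReal lam) q ≠ ∞)
    {b p : Measure (Fin D → ℝ)} [IsProbabilityMeasure b] (hb : b ≪ posterior prior ℓ)
    (hbint : ∀ φ : Fin D → ℝ → ℝ, (∀ i, Measurable (φ i)) →
      Integrable (fun θ => ℓ θ - ∑ i, φ i (θ i)) b →
      Integrable (fun θ => ℓ θ - ∑ i, φ i (θ i)) (Measure.pi (marginals b)) →
      ∀ i, Integrable (φ i) (marginals b i))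
    {L C : ℝ≥0} (hL : LipschitzCost Θ ℓ L (marginals q) (marginals b))
    (hC : TransportInequality Θ C (marginals b))
    (hp : IsEOTOptimizer Θ ℓ lam (marginals b) p) {δ : ℝ≥0∞} (hδ : transportCost q b < δ)
    (hδtop : δ ≠ ∞) :
    transportCost p q ≤ stabilityModulus L C δ := by
  have := isProbabilityMeasure_posterior hZ
  have hqprob : IsProbabilityMeasure q := hq.1.1.1
  have hpprob : IsProbabilityMeasure p := hp.1.1.1.1
  have hac₁ := posterior_absolutelyContinuous prior ℓ
  have hac₂ := absolutelyContinuous_posterior hZ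
  have hqac : q ≪ posterior prior ℓ := (klDiv_ne_top_iff.1 (ENNReal.add_ne_top.1 hF).1).1
  have hklq : klDiv q (Measure.pi (marginals q)) ≠ ∞ := fun h => (ENNReal.add_ne_top.1 hF).2 (by
    rw [expressivity, h, ENNReal.mul_top (ENNReal.ofReal_pos.2 hlam).ne'])
  have hmq : Measure.pi (marginals q) ≪ posterior prior ℓ :=
    pi_marginals_absolutelyContinuous hac₁ hac₂ hqac
  have hmb : Measure.pi (marginals b) ≪ posterior prior ℓ :=
    pi_marginals_absolutelyContinuous hac₁ hac₂ hb
  have hpm : ∀ r : Measure (Fin D → ℝ), IsProbabilityMeasure r → r ≪ posterior prior ℓ →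
      r ∈ probMeasures Θ := fun r _ h => mem_probMeasures_of_absolutelyContinuous hpost.1 h
  have cq : q ∈ couplings Θ (marginals q) := ⟨hq.1.1, rfl⟩
  have cmq : Measure.pi (marginals q) ∈ couplings Θ (marginals q) :=
    ⟨hpm _ inferInstance hmq, marginals_pi _⟩
  have cb : b ∈ couplings Θ (marginals b) := ⟨hpm _ inferInstance hb, rfl⟩
  have cmb : Measure.pi (marginals b) ∈ couplings Θ (marginals b) :=
    ⟨hpm _ inferInstance hmb, marginals_pi _⟩
  obtain ⟨φ, hφ, hlip⟩ := hL
  have hφi := hbint φ hφ (hlip q cq b cb).2.1 (hlip q cq _ cmb).2.1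
  obtain ⟨γ, hγ, hγδ⟩ := exists_plan_lt hδ
  -- the shadow `r` of `q` on the marginals of `b`
  obtain ⟨r, hr, hrm, hrT, hrkl⟩ := exists_shadow (q := q) rfl hγ
  have hrkl' : klDiv r (Measure.pi (marginals b)) ≠ ∞ := ne_top_of_le_ne_top hklq hrkl
  have cr : r ∈ couplings Θ (marginals b) :=
    ⟨hpm r hr ((klDiv_ne_top_iff.1 hrkl').1.trans hmb), hrm⟩
  -- the shadow `s` of `p` on the marginals of `q`
  have hγswap : γ.map Prod.swap ∈ transportPlans b q := by
    refine ⟨?_, ?_⟩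
    · rw [Measure.map_map measurable_fst measurable_swap]; exact hγ.2
    · rw [Measure.map_map measurable_snd measurable_swap]; exact hγ.1
  have hcost : ∫⁻ z, ENNReal.ofReal (euclSq (z.1 - z.2)) ∂(γ.map Prod.swap)
      = ∫⁻ z, ENNReal.ofReal (euclSq (z.1 - z.2)) ∂γ := by
    rw [lintegral_map (by fun_prop) measurable_swap]
    exact lintegral_congr fun z => by rw [Prod.fst_swap, Prod.snd_swap, euclSq_sub_comm]
  obtain ⟨s, hs, hsm, hsT, hskl⟩ := exists_shadow (q := p) hp.1.1.2 hγswap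
  have hskl' : klDiv s (Measure.pi (marginals q)) ≠ ∞ := ne_top_of_le_ne_top hp.1.2.2 hskl
  have cs : s ∈ couplings Θ (marginals q) :=
    ⟨hpm s hs ((klDiv_ne_top_iff.1 hskl').1.trans hmq), hsm⟩
  have hopt := xiPosterior_optimal hZ hpost hlam hq hF hφ (hlip q cq b cb).1
    (hlip _ cmq b cb).1 hs hsm hskl' (hlip s cs b cb).1
  have hexc := eot_excess hp hφ hφi (hlip q cq p hp.1.1).2.1 cr hrkl' (hlip q cq r cr).2.1
  set h := (2⁻¹ : ℝ≥0∞) • (r + p) with hh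
  have hhprob : IsProbabilityMeasure h := hexc.1.1.1
  -- both gaps of the linear terms are at most `w`
  set w : ℝ≥0∞ := L * δ ^ (1 / 2 : ℝ) with hw
  have hwtop : w ≠ ∞ := by
    rw [hw]; exact ENNReal.mul_ne_top (by simp) (ENNReal.rpow_ne_top_of_nonneg (by norm_num) hδtop)
  have hgap : ∀ q₁ ∈ couplings Θ (marginals q), ∀ q₂ ∈ couplings Θ (marginals b),
      transportCost q₁ q₂ ≤ δ →
      |∫ θ, (ℓ θ - ∑ i, φ i (θ i)) ∂q₁ - ∫ θ, (ℓ θ - ∑ i, φ i (θ i)) ∂q₂| ≤ w.toReal := by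
    intro q₁ h₁ q₂ h₂ hT
    rw [← ENNReal.ofReal_le_iff_le_toReal hwtop]
    refine (hlip q₁ h₁ q₂ h₂).2.2.trans ?_
    rw [hw, wasserstein2_eq]
    gcongr
  have hg1 := (abs_le.1 (hgap q cq r cr (hrT.trans hγδ.le))).2
  have hg2 := (abs_le.1 (hgap s cs p hp.1.1
    (by rw [transportCost_comm]; exact hsT.trans (hcost.trans_le hγδ.le)))).1
  have hk1 := ENNReal.toReal_mono hklq hrkl
  have hk2 := ENNReal.toReal_mono hp.1.2.2 hskl
  have hlam1 : (0 : ℝ) < lam + 1 := by linarith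
  -- the factor `λ + 1` of the excess is discarded, which makes the bound uniform in `λ`
  have hsum : (klDiv r h).toReal + (klDiv p h).toReal ≤ 2 * w.toReal := by
    have hn : 0 ≤ (klDiv r h).toReal + (klDiv p h).toReal := by positivity
    have := hexc.2
    have m1 := mul_le_mul_of_nonneg_left hk1 hlam1.le
    have m2 := mul_le_mul_of_nonneg_left hk2 hlam1.le
    have : (lam + 1) * ((klDiv r h).toReal + (klDiv p h).toReal) ≤ 2 * w.toReal := by
      rw [add_comm 1 lam] at hopt
      linarith
    nlinarith
  have hrh : klDiv r h ≠ ∞ :=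
    klDiv_ne_top_of_le_smul (c := 2) (by simp) (le_two_smul_midpoint r p)
  have hph : klDiv p h ≠ ∞ := klDiv_ne_top_of_le_smul (c := 2) (by simp) (by
    rw [hh, add_comm r p]; exact le_two_smul_midpoint p r)
  have hbound : ∀ x : ℝ≥0∞, x ≠ ∞ → x.toReal ≤ 2 * w.toReal → x ≤ 2 * w := by
    intro x hx hle
    rw [← ENNReal.toReal_le_toReal hx (ENNReal.mul_ne_top (by simp) hwtop), ENNReal.toReal_mul]
    simpa using hle
  have hTr : transportCost r h ≤ C ^ 2 * (2 * w) ^ (1 / 2 : ℝ) := by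
    refine (transportCost_le_of_transportInequality hC cr hexc.1).trans ?_
    gcongr
    exact hbound _ hrh (by linarith [ENNReal.toReal_nonneg (a := klDiv p h)])
  have hTp : transportCost p h ≤ C ^ 2 * (2 * w) ^ (1 / 2 : ℝ) := by
    refine (transportCost_le_of_transportInequality hC hp.1.1 hexc.1).trans ?_
    gcongr
    exact hbound _ hph (by linarith [ENNReal.toReal_nonneg (a := klDiv r h)])
  calc transportCost p q ≤ 2 * transportCost p r + 2 * transportCost r q :=
        transportCost_triangle _ _ _
    _ ≤ 2 * (2 * transportCost p h + 2 * transportCost h r) + 2 * transportCost r q := by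
        gcongr; exact transportCost_triangle _ _ _
    _ ≤ 2 * (2 * (C ^ 2 * (2 * w) ^ (1 / 2 : ℝ)) + 2 * (C ^ 2 * (2 * w) ^ (1 / 2 : ℝ)))
          + 2 * δ := by
        rw [transportCost_comm h r, transportCost_comm r q]
        gcongr
        exact hrT.trans hγδ.le
    _ = stabilityModulus L C δ := by
        rw [stabilityModulus, hw, mul_assoc 2 (L : ℝ≥0∞)]; ring

/-- Since the modulus of stability vanishes at `0`, a quantity bounded by it tends to `0` along with
the distance it is applied to. -/
lemma tendsto_transportCost_of_le_modulus {ι : Type*} {l : Filter ι} {T S : ι → ℝ≥0∞} {L C : ℝ≥0}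
    (hT : Tendsto T l (𝓝 0))
    (hS : ∀ᶠ i in l, ∀ δ : ℝ≥0∞, T i < δ → δ ≠ ∞ → S i ≤ stabilityModulus L C δ) :
    Tendsto S l (𝓝 0) := by
  rw [ENNReal.tendsto_nhds_zero]
  intro ε hε
  have h1 := ENNReal.tendsto_nhds_zero.1 (tendsto_stabilityModulus L C) ε hε
  obtain ⟨δ, hδ0, hδ⟩ := ENNReal.nhds_zero_basis.eventually_iff.1 h1
  obtain ⟨δ', hδ'0, hδ'⟩ := exists_between (lt_min hδ0 one_pos)
  filter_upwards [hS, hT.eventually_lt_const hδ'0] with i hi hlt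
  exact (hi δ' hlt (hδ'.trans_le (min_le_right _ _) |>.ne_top)).trans
    (hδ (Set.mem_Iio.2 (hδ'.trans_le (min_le_left _ _))))

/-! ### Setwise limits and the limits of variational posteriors -/

/-- Along an ultrafilter, every family of probability measures dominated by a finite measure
converges setwise: domination makes the setwise limit countably additive. -/
lemma exists_setwise_limit {α ι : Type*} [MeasurableSpace α] (U : Ultrafilter ι)
    {μ : ι → Measure α} {κ : Measure α} [IsFiniteMeasure κ]
    (hprob : ∀ᶠ i in (U : Filter ι), IsProbabilityMeasure (μ i))
    (hle : ∀ᶠ i in (U : Filter ι), μ i ≤ κ) :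
    ∃ ν : Measure α, IsProbabilityMeasure ν ∧ ν ≤ κ ∧
      ∀ A, MeasurableSet A → Tendsto (fun i => μ i A) U (𝓝 (ν A)) := by
  have hlim : ∀ A : Set α, ∃ x : ℝ≥0∞, Tendsto (fun i => μ i A) U (𝓝 x) := fun A => by
    obtain ⟨x, -, hx⟩ := isCompact_univ.ultrafilter_le_nhds (U.map fun i => μ i A) (by simp)
    exact ⟨x, hx⟩
  choose p hp using hlim
  have hpκ : ∀ A, p A ≤ κ A := fun A =>
    le_of_tendsto (hp A) (hle.mono fun i hi => hi A)
  have h0 : p ∅ = 0 := tendsto_nhds_unique (hp ∅) (by simp)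
  have hU : ∀ ⦃f : ℕ → Set α⦄, (∀ i, MeasurableSet (f i)) → Pairwise (Function.onFun Disjoint f) →
      p (⋃ i, f i) = ∑' i, p (f i) := by
    intro f hf hd
    have hsum : ∀ N, Tendsto (fun i => ∑ j ∈ Finset.range N, μ i (f j)) U
        (𝓝 (∑ j ∈ Finset.range N, p (f j))) := fun N =>
      tendsto_finsetSum _ fun j _ => hp (f j)
    refine le_antisymm ?_ ?_
    · have hκ : ∑' j, κ (f j) ≠ ∞ := by
        rw [← measure_iUnion hd hf]; exact measure_ne_top _ _
      have htail := ENNReal.tendsto_sum_nat_add (fun j => κ (f j)) hκ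
      have hN : ∀ N, p (⋃ i, f i) ≤ ∑' i, p (f i) + ∑' j, κ (f (j + N)) := by
        intro N
        have h1 : p (⋃ i, f i) ≤ ∑ j ∈ Finset.range N, p (f j) + ∑' j, κ (f (j + N)) := by
          refine le_of_tendsto_of_tendsto (hp _) ((hsum N).add_const _) ?_
          filter_upwards [hle] with i hi
          rw [measure_iUnion hd hf, ← ENNReal.summable.sum_add_tsum_nat_add' (k := N)]
          gcongr
        exact h1.trans (by gcongr; exact ENNReal.sum_le_tsum _)
      have := ge_of_tendsto' (htail.const_add (∑' i, p (f i))) hN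
      simpa using this
    · refine ENNReal.tsum_le_of_sum_range_le fun N => ?_
      refine le_of_tendsto_of_tendsto (hsum N) (hp _) (Eventually.of_forall fun i => ?_)
      simp only
      rw [measure_iUnion hd hf]
      exact ENNReal.sum_le_tsum _
  let ν : Measure α := Measure.ofMeasurable (fun A _ => p A) h0 hU
  have hν : ∀ A, MeasurableSet A → ν A = p A := fun A hA => Measure.ofMeasurable_apply A hA
  refine ⟨ν, ⟨?_⟩, Measure.le_iff.2 fun A hA => (hν A hA).trans_le (hpκ A),
    fun A hA => by rw [hν A hA]; exact hp A⟩
  rw [hν _ MeasurableSet.univ]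
  refine tendsto_nhds_unique (hp _) (tendsto_const_nhds.congr' ?_)
  filter_upwards [hprob] with i hi
  exact measure_univ.symm

lemma tendsto_integral_of_setwise {α ι : Type*} [MeasurableSpace α] {l : Filter ι}
    {μ : ι → Measure α} {ν κ : Measure α} [IsFiniteMeasure κ] [IsProbabilityMeasure ν]
    (hprob : ∀ᶠ i in l, IsProbabilityMeasure (μ i)) (hle : ∀ᶠ i in l, μ i ≤ κ) (hν : ν ≤ κ)
    (hset : ∀ A, MeasurableSet A → Tendsto (fun i => μ i A) l (𝓝 (ν A)))
    {h : α → ℝ} (hh : Measurable h) {C : ℝ} (hC : ∀ x, |h x| ≤ C) :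
    Tendsto (fun i => ∫ x, h x ∂(μ i)) l (𝓝 (∫ x, h x ∂ν)) := by
  rw [Metric.tendsto_nhds]
  intro ε hε
  have hhκ : Integrable h κ := integrable_of_abs_le hh C hC
  obtain ⟨g, hg, -⟩ := (memLp_one_iff_integrable.2 hhκ).exists_simpleFunc_eLpNorm_sub_lt
    (by simp) (ε := ENNReal.ofReal (ε / 3)) (ENNReal.ofReal_pos.2 (by linarith)).ne'
  rw [eLpNorm_one_eq_lintegral_enorm] at hg
  have happrox : ∀ ρ : Measure α, IsProbabilityMeasure ρ → ρ ≤ κ →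
      |∫ x, h x ∂ρ - ∫ x, g x ∂ρ| ≤ ε / 3 := by
    intro ρ hρ hρκ
    have h1 : Integrable h ρ := integrable_of_abs_le hh C hC
    have h2 : Integrable g ρ := SimpleFunc.integrable_of_isFiniteMeasure g
    rw [← integral_sub h1 h2, ← Real.norm_eq_abs]
    refine (norm_integral_le_lintegral_norm _).trans ?_
    refine ENNReal.toReal_le_of_le_ofReal (by linarith) ?_
    refine le_trans ?_ hg.le
    simp only [ofReal_norm]
    exact lintegral_mono' hρκ le_rfl
  have hgt : Tendsto (fun i => ∫ x, g x ∂(μ i)) l (𝓝 (∫ x, g x ∂ν)) := by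
    have e : ∀ ρ : Measure α, IsProbabilityMeasure ρ →
        ∫ x, g x ∂ρ = ∑ y ∈ g.range, ρ.real (g ⁻¹' {y}) • y := fun ρ hρ => by
      rw [← SimpleFunc.integral_eq_integral _ (SimpleFunc.integrable_of_isFiniteMeasure g),
        SimpleFunc.integral_eq]
    rw [e ν inferInstance]
    have ht : Tendsto (fun i => ∑ y ∈ g.range, (μ i).real (g ⁻¹' {y}) • y) l
        (𝓝 (∑ y ∈ g.range, ν.real (g ⁻¹' {y}) • y)) :=
      tendsto_finsetSum _ fun y _ => Tendsto.smul_const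
        ((ENNReal.tendsto_toReal (measure_ne_top _ _)).comp (hset _ (g.measurableSet_fiber y))) y
    refine ht.congr' ?_
    filter_upwards [hprob] with i hi
    exact (e _ hi).symm
  filter_upwards [hprob, hle, Metric.tendsto_nhds.1 hgt (ε / 3) (by linarith)] with i h1 h2 h3
  rw [Real.dist_eq] at h3 ⊢
  have a1 := abs_le.1 (happrox (μ i) h1 h2)
  have a2 := abs_le.1 (happrox ν inferInstance hν)
  have a3 := abs_lt.1 h3
  exact abs_lt.2 ⟨by linarith [a1.1, a2.2, a3.1], by linarith [a1.2, a2.1, a3.2]⟩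

/-- Lower semicontinuity of the Kullback–Leibler divergence under dominated setwise convergence. -/
lemma klDiv_le_of_setwise {α ι : Type*} [MeasurableSpace α] {l : Filter ι} [l.NeBot]
    {μ : ι → Measure α} {ν κ q₀ : Measure α} [IsFiniteMeasure κ] [IsProbabilityMeasure ν]
    [IsProbabilityMeasure q₀]
    (hprob : ∀ᶠ i in l, IsProbabilityMeasure (μ i)) (hle : ∀ᶠ i in l, μ i ≤ κ) (hν : ν ≤ κ)
    (hset : ∀ A, MeasurableSet A → Tendsto (fun i => μ i A) l (𝓝 (ν A))) {K : ℝ≥0∞}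
    (hK : ∀ᶠ i in l, klDiv (μ i) q₀ ≤ K) : klDiv ν q₀ ≤ K := by
  by_cases htop : K = ∞
  · rw [htop]; exact le_top
  rw [← ENNReal.ofReal_toReal htop]
  refine klDiv_le_of_forall_integral_le fun h hh ⟨C, hC⟩ => ?_
  refine le_of_tendsto (tendsto_integral_of_setwise hprob hle hν hset hh hC) ?_
  filter_upwards [hprob, hK] with i h1 h2
  have h3 := integral_le_toReal_klDiv_add (ne_top_of_le_ne_top htop h2)
    (integrable_of_abs_le hh C hC) (integrable_exp_of_abs_le hh C hC)
  linarith [ENNReal.toReal_mono htop h2]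

lemma tendsto_wasserstein2_of_transportCost {D : ℕ} {ι : Type*} {l : Filter ι}
    {μ ν : ι → Measure (Fin D → ℝ)}
    (h : Tendsto (fun i => transportCost (μ i) (ν i)) l (𝓝 0)) :
    Tendsto (fun i => wasserstein2 (μ i) (ν i)) l (𝓝 0) := by
  simp_rw [wasserstein2_eq]
  have := ((ENNReal.continuous_rpow_const (y := (1 / 2 : ℝ))).tendsto 0).comp h
  simpa [Function.comp_def] using this

/-- A product measure can be conditioned on a bounded box of positive mass. The result is a product
measure with a finite second moment, dominated by a multiple of the original one. -/
lemma exists_truncation {D : ℕ} (m : Fin D → Measure ℝ) [∀ i, IsProbabilityMeasure (m i)] :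
    ∃ m' : Fin D → Measure ℝ, (∀ i, IsProbabilityMeasure (m' i)) ∧
      (∃ c : ℝ≥0∞, c ≠ ∞ ∧ Measure.pi m' ≤ c • Measure.pi m) ∧
      ∫⁻ θ, ENNReal.ofReal (euclSq θ) ∂(Measure.pi m') < ∞ := by
  have hR : ∀ i, ∃ R : ℕ, m i (Set.Icc (-(R : ℝ)) R) ≠ 0 := by
    intro i
    by_contra! hall
    have hU : (⋃ R : ℕ, Set.Icc (-(R : ℝ)) R) = Set.univ := by
      ext x
      simp only [Set.mem_iUnion, Set.mem_Icc, Set.mem_univ, iff_true]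
      obtain ⟨R, hR⟩ := exists_nat_ge |x|
      exact ⟨R, abs_le.1 hR⟩
    have := measure_iUnion_null hall
    rw [hU, measure_univ] at this
    exact one_ne_zero this
  choose R hR using hR
  let B : Fin D → Set ℝ := fun i => Set.Icc (-(R i : ℝ)) (R i)
  let m' : Fin D → Measure ℝ := fun i => (m i (B i))⁻¹ • (m i).restrict (B i)
  have hm' : ∀ i, IsProbabilityMeasure (m' i) := fun i => ⟨by
    simp only [m', Measure.smul_apply, Measure.restrict_apply MeasurableSet.univ, Set.univ_inter,
      smul_eq_mul]
    exact ENNReal.inv_mul_cancel (hR i) (measure_ne_top _ _)⟩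
  have hinv : ∀ i, (m i (B i))⁻¹ ≠ ∞ := fun i => ENNReal.inv_ne_top.2 (hR i)
  refine ⟨m', hm', ⟨(∑ i, (m i (B i))⁻¹) ^ D,
    ENNReal.pow_ne_top (ENNReal.sum_ne_top.2 fun i _ => hinv i), ?_⟩, ?_⟩
  · refine pi_le_smul_pi fun i => Measure.le_iff.2 fun A hA => ?_
    simp only [m', Measure.smul_apply, smul_eq_mul]
    gcongr
    · exact Finset.single_le_sum (f := fun i => (m i (B i))⁻¹) (fun _ _ => zero_le)
        (Finset.mem_univ i)
    · exact Measure.restrict_le_self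
  · rw [lintegral_euclSq_eq_sum, marginals_pi]
    refine ENNReal.sum_lt_top.2 fun i _ => ?_
    simp only [m']
    rw [lintegral_smul_measure]
    refine ENNReal.mul_lt_top (hinv i).lt_top ?_
    calc ∫⁻ x in B i, ENNReal.ofReal (x ^ 2) ∂(m i)
        ≤ ∫⁻ _x in B i, ENNReal.ofReal ((R i : ℝ) ^ 2) ∂(m i) := by
          refine setLIntegral_mono measurable_const fun x hx => ENNReal.ofReal_le_ofReal ?_
          exact sq_le_sq' hx.1 hx.2
      _ < ∞ := by
          rw [setLIntegral_const]
          exact ENNReal.mul_lt_top ENNReal.ofReal_lt_top (measure_lt_top _ _)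

/-- If some product measure has finite divergence from the posterior, the objectives of all
`Ξ`-variational posteriors are bounded uniformly in `λ`. The product measure serves as a competitor
after truncation, as it need not have a second moment. -/
lemma exists_xiObjective_le {D : ℕ} {Θ : Fin D → Set ℝ} {q₀ : Measure (Fin D → ℝ)}
    (h₀ : q₀ ∈ probMeasures2 Θ) {m : Fin D → Measure ℝ} (hm : ∀ i, IsProbabilityMeasure (m i))
    (hkl : klDiv (Measure.pi m) q₀ ≠ ∞) :
    ∃ K : ℝ, 0 ≤ K ∧ ∀ lam : ℝ≥0∞, ∀ q ∈ xiPosteriors Θ q₀ lam,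
      xiObjective q₀ lam q ≤ ENNReal.ofReal K := by
  have := h₀.1.1
  obtain ⟨m', hm', ⟨c, hc, hle⟩, h2⟩ := exists_truncation m
  have hkl' : klDiv (Measure.pi m') q₀ ≠ ∞ := klDiv_ne_top_of_le_smul_of_ne_top hc hle hkl
  refine ⟨(klDiv (Measure.pi m') q₀).toReal, ENNReal.toReal_nonneg, fun lam q hq => ?_⟩
  rw [ENNReal.ofReal_toReal hkl']
  refine (hq.2 (Measure.pi m') ⟨mem_probMeasures_of_absolutelyContinuous h₀.1
    (klDiv_ne_top_iff.1 hkl').1, h2⟩).trans_eq ?_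
  simp [xiObjective, expressivity, marginals_pi]

/-- Every ultrafilter limit of `Ξ`-variational posteriors as `λ → ∞` is a mean-field variational
posterior, and the convergence holds in the Wasserstein distance. -/
lemma exists_meanField_limit {D : ℕ} {Θ : Fin D → Set ℝ} {q₀ : Measure (Fin D → ℝ)}
    (h₀ : q₀ ∈ probMeasures2 Θ) {n : Fin D → Measure ℝ} [∀ i, IsProbabilityMeasure (n i)]
    (hac₁ : q₀ ≪ Measure.pi n) (hac₂ : Measure.pi n ≪ q₀)
    {q : ℝ → Measure (Fin D → ℝ)}
    (hq : ∀ lam : ℝ, 0 < lam → q lam ∈ xiPosteriors Θ q₀ (ENNReal.ofReal lam)) {K : ℝ}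
    (hK : 0 ≤ K)
    (hF : ∀ lam : ℝ, 0 < lam → xiObjective q₀ (ENNReal.ofReal lam) (q lam) ≤ ENNReal.ofReal K)
    (U : Ultrafilter ℝ) (hU : (U : Filter ℝ) ≤ atTop) :
    ∃ p ∈ xiPosteriors Θ q₀ ∞, p = Measure.pi (marginals p) ∧ p ≪ q₀ ∧
      Tendsto (fun lam => transportCost p (q lam)) U (𝓝 0) := by
  have := h₀.1.1
  have hpos : ∀ᶠ lam : ℝ in (U : Filter ℝ), 0 < lam := hU (eventually_gt_atTop 0)
  have hprob : ∀ᶠ lam in (U : Filter ℝ), IsProbabilityMeasure (q lam) :=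
    hpos.mono fun lam h => (hq lam h).1.1.1
  have hκfin := isFiniteMeasure_dominatingMeasure q₀ K
  have hle : ∀ᶠ lam in (U : Filter ℝ), q lam ≤ dominatingMeasure q₀ K :=
    hpos.mono fun lam h => xiPosterior_le_dominating h₀ hac₁ hac₂ h (hq lam h) (hF lam h) hK
  obtain ⟨p, hp, hpκ, hset⟩ := exists_setwise_limit U hprob hle
  have hκ2 := lintegral_euclSq_dominatingMeasure_lt_top h₀.2 K
  have hpq₀ : p ≪ q₀ := by
    refine (Measure.absolutelyContinuous_of_le hpκ).trans
      (Measure.AbsolutelyContinuous.add_left_iff.2 ⟨Measure.smul_absolutelyContinuous, ?_⟩)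
    exact Measure.smul_absolutelyContinuous.trans
      (pi_marginals_absolutelyContinuous hac₁ hac₂ Measure.AbsolutelyContinuous.rfl)
  have hp2 : p ∈ probMeasures2 Θ :=
    ⟨mem_probMeasures_of_absolutelyContinuous h₀.1 hpq₀, (lintegral_mono' hpκ le_rfl).trans_lt hκ2⟩
  -- the expressivity is at most `K / λ`, so the limit is a product measure
  have hΞ : Tendsto (fun lam => klDiv (q lam) (Measure.pi (marginals (q lam)))) U (𝓝 0) := by
    have hlim : Tendsto (fun lam : ℝ => ENNReal.ofReal (K / lam)) U (𝓝 0) := by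
      have h1 : Tendsto (fun lam : ℝ => K / lam) U (𝓝 0) :=
        (tendsto_id.const_div_atTop K).mono_left hU
      simpa [Function.comp_def] using (ENNReal.continuous_ofReal.tendsto 0).comp h1
    refine tendsto_of_tendsto_of_tendsto_of_le_of_le' tendsto_const_nhds hlim
      (Eventually.of_forall fun _ => zero_le) ?_
    filter_upwards [hpos] with lam h
    rw [ENNReal.ofReal_div_of_pos h,
      ENNReal.le_div_iff_mul_le (Or.inl (ENNReal.ofReal_pos.2 h).ne')
        (Or.inl ENNReal.ofReal_ne_top),
      mul_comm]
    exact le_add_self.trans (hF lam h)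
  have hprod : Measure.pi (marginals p) = p := by
    refine Measure.pi_eq fun s hs => ?_
    have hbox := MeasurableSet.univ_pi hs
    have hsi : ∀ i, MeasurableSet ((fun θ : Fin D → ℝ => θ i) ⁻¹' s i) := fun i =>
      measurable_pi_apply i (hs i)
    have h1 := tendsto_measureReal_sub_of_klDiv hprob (hprob.mono fun lam h => inferInstance)
      hΞ hbox
    have h2 : Tendsto (fun lam => (q lam).real (Set.univ.pi s)) U (𝓝 (p.real (Set.univ.pi s))) :=
      (ENNReal.tendsto_toReal (measure_ne_top _ _)).comp (hset _ hbox)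
    have h3 : Tendsto (fun lam => (Measure.pi (marginals (q lam))).real (Set.univ.pi s)) U
        (𝓝 (∏ i, p.real ((fun θ => θ i) ⁻¹' s i))) := by
      have h4 : Tendsto (fun lam => ∏ i, (q lam).real ((fun θ => θ i) ⁻¹' s i)) U
          (𝓝 (∏ i, p.real ((fun θ => θ i) ⁻¹' s i))) :=
        tendsto_finsetProd _ fun i _ =>
          (ENNReal.tendsto_toReal (measure_ne_top _ _)).comp (hset _ (hsi i))
      refine h4.congr' ?_
      filter_upwards [hprob] with lam h
      rw [measureReal_def, Measure.pi_pi, ENNReal.toReal_prod]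
      simp only [marginals_apply _ _ (hs _), measureReal_def]
    have h5 := tendsto_nhds_unique (h2.sub h3) h1
    rw [sub_eq_zero, measureReal_def] at h5
    rw [← ENNReal.toReal_eq_toReal_iff' (measure_ne_top _ _)
      (ENNReal.prod_ne_top fun i _ => measure_ne_top _ _), h5, ENNReal.toReal_prod]
    simp only [marginals_apply _ _ (hs _), measureReal_def]
  refine ⟨p, ⟨hp2, fun q' hq' => ?_⟩, hprod.symm, hpq₀,
    tendsto_transportCost hκ2 hprob hle hpκ hset⟩
  have hobj : xiObjective q₀ ∞ p = klDiv p q₀ := by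
    rw [xiObjective, expressivity, hprod, klDiv_self, mul_zero, add_zero]
  rw [hobj]
  by_cases hΞ' : expressivity q' = 0
  · have hobj' : ∀ lam, xiObjective q₀ lam q' = klDiv q' q₀ := fun lam => by
      rw [xiObjective, hΞ', mul_zero, add_zero]
    rw [hobj' ∞]
    refine klDiv_le_of_setwise hprob hle hpκ hset ?_
    filter_upwards [hpos] with lam h
    exact le_self_add.trans (((hq lam h).2 q' hq').trans_eq (hobj' _))
  -- a competitor that is not a product measure has infinite objective for `λ = ∞`
  · rw [xiObjective, ENNReal.top_mul hΞ', add_top]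
    exact le_top

/-- The `Ξ`-variational posteriors converge to the exact posterior as `λ → 0`. -/
lemma tendsto_transportCost_posterior {D : ℕ} {Θ : Fin D → Set ℝ} {q₀ : Measure (Fin D → ℝ)}
    (h₀ : q₀ ∈ probMeasures2 Θ) {n : Fin D → Measure ℝ} [∀ i, IsProbabilityMeasure (n i)]
    (hac₁ : q₀ ≪ Measure.pi n) (hac₂ : Measure.pi n ≪ q₀) (hΞ : expressivity q₀ ≠ ∞)
    {q : ℝ → Measure (Fin D → ℝ)}
    (hq : ∀ lam : ℝ, 0 < lam → q lam ∈ xiPosteriors Θ q₀ (ENNReal.ofReal lam)) :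
    (∀ lam : ℝ, 0 < lam → xiObjective q₀ (ENNReal.ofReal lam) (q lam) ≠ ∞) ∧
    Tendsto (fun lam => transportCost q₀ (q lam)) (𝓝[>] 0) (𝓝 0) := by
  have := h₀.1.1
  have hF : ∀ lam : ℝ, 0 < lam → xiObjective q₀ (ENNReal.ofReal lam) (q lam)
      ≤ ENNReal.ofReal lam * expressivity q₀ := fun lam h => by
    refine ((hq lam h).2 q₀ h₀).trans_eq ?_
    rw [xiObjective, klDiv_self, zero_add]
  refine ⟨fun lam h => ne_top_of_le_ne_top (ENNReal.mul_ne_top ENNReal.ofReal_ne_top hΞ) (hF lam h),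
    ?_⟩
  have hpos : ∀ᶠ lam : ℝ in 𝓝[>] 0, 0 < lam := eventually_mem_nhdsWithin
  have hlt : ∀ᶠ lam : ℝ in 𝓝[>] 0, lam < 1 :=
    eventually_nhdsWithin_of_eventually_nhds (eventually_lt_nhds one_pos)
  have hprob : ∀ᶠ lam in 𝓝[>] 0, IsProbabilityMeasure (q lam) :=
    hpos.mono fun lam h => (hq lam h).1.1.1
  have hle : ∀ᶠ lam in 𝓝[>] 0, q lam ≤ dominatingMeasure q₀ (expressivity q₀).toReal := by
    filter_upwards [hpos, hlt] with lam h h1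
    refine xiPosterior_le_dominating h₀ hac₁ hac₂ h (hq lam h) ((hF lam h).trans ?_)
      ENNReal.toReal_nonneg
    rw [ENNReal.ofReal_toReal hΞ]
    refine mul_le_of_le_one_left zero_le ?_
    exact ENNReal.ofReal_le_one.2 h1.le
  have hq₀κ : q₀ ≤ dominatingMeasure q₀ (expressivity q₀).toReal := by
    refine Measure.le_iff.2 fun A _ => ?_
    simp only [dominatingMeasure, Measure.add_apply, Measure.smul_apply, smul_eq_mul]
    refine le_trans (le_mul_of_one_le_left zero_le ?_) le_self_add
    exact ENNReal.one_le_ofReal.2 (Real.one_le_exp ENNReal.toReal_nonneg)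
  have hkl : Tendsto (fun lam => klDiv (q lam) q₀) (𝓝[>] 0) (𝓝 0) := by
    have hlim : Tendsto (fun lam : ℝ => ENNReal.ofReal lam * expressivity q₀) (𝓝[>] 0) (𝓝 0) := by
      have h1 : Tendsto (fun lam : ℝ => ENNReal.ofReal lam) (𝓝[>] 0) (𝓝 0) := by
        simpa using (ENNReal.continuous_ofReal.tendsto 0).mono_left nhdsWithin_le_nhds
      simpa using ENNReal.Tendsto.mul_const h1 (Or.inr hΞ)
    refine tendsto_of_tendsto_of_tendsto_of_le_of_le' tendsto_const_nhds hlim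
      (Eventually.of_forall fun _ => zero_le) ?_
    filter_upwards [hpos] with lam h
    exact le_self_add.trans (hF lam h)
  have hset : ∀ A, MeasurableSet A → Tendsto (fun lam => q lam A) (𝓝[>] 0) (𝓝 (q₀ A)) := by
    intro A hA
    have h1 := (tendsto_measureReal_sub_of_klDiv hprob (Eventually.of_forall fun _ => inferInstance)
      hkl hA).add_const (q₀.real A)
    simp only [sub_add_cancel, zero_add] at h1
    have h2 := (ENNReal.continuous_ofReal.tendsto _).comp h1
    rw [ofReal_measureReal] at h2
    refine h2.congr' ?_
    filter_upwards [hprob] with lam h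
    exact ofReal_measureReal
  exact tendsto_transportCost (lintegral_euclSq_dominatingMeasure_lt_top h₀.2 _) hprob hle hq₀κ hset

/-! ### Convergence of entropic couplings to variational posteriors -/

theorem corollaryA6 {D : ℕ} (Θ : Fin D → Set ℝ) (hΘ : ∀ i, MeasurableSet (Θ i))
    (prior : Fin D → Measure ℝ) (hprior : ∀ i, IsProbabilityMeasure (prior i))
    (hdens : ∀ i, prior i ≪ volume) (hsupp : ∀ i, prior i (Θ i)ᶜ = 0)
    (ℓ : (Fin D → ℝ) → ℝ) (hℓ : Measurable ℓ)
    (hZ : Integrable (fun θ => Real.exp (ℓ θ)) (Measure.pi prior))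
    (hpost : posterior prior ℓ ∈ probMeasures2 Θ)
    -- a `Ξ`-variational posterior for every positive `λ`
    (q : ℝ → Measure (Fin D → ℝ))
    (hq : ∀ lam : ℝ, 0 < lam →
      q lam ∈ xiPosteriors Θ (posterior prior ℓ) (ENNReal.ofReal lam)) :
    -- `λ → ∞`, marginals of a mean-field variational posterior
    ((∃ m : Fin D → Measure ℝ, (∀ i, IsProbabilityMeasure (m i)) ∧
        klDiv (Measure.pi m) (posterior prior ℓ) ≠ ∞) →
      (∀ p ∈ xiPosteriors Θ (posterior prior ℓ) ∞,
        Integrable ℓ p ∧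
        (∃ L : ℝ≥0, ∀ lam : ℝ, 0 < lam →
          LipschitzCost Θ ℓ L (marginals (q lam)) (marginals p)) ∧
        (∃ C : ℝ≥0, TransportInequality Θ C (marginals p))) →
      ∀ qInf : Measure (Fin D → ℝ) → ℝ → Measure (Fin D → ℝ),
        (∀ p ∈ xiPosteriors Θ (posterior prior ℓ) ∞, ∀ lam : ℝ, 0 < lam →
          IsEOTOptimizer Θ ℓ lam (marginals p) (qInf p lam)) →
        (∀ p, xiPosteriors Θ (posterior prior ℓ) ∞ = {p} →
          Tendsto (fun lam => wasserstein2 (qInf p lam) (q lam)) atTop (𝓝 0)) ∧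
        Tendsto (fun lam => ⨅ p ∈ xiPosteriors Θ (posterior prior ℓ) ∞,
          wasserstein2 (qInf p lam) (q lam)) atTop (𝓝 0)) ∧
    -- `λ → 0`, marginals of the exact posterior
    (Integrable ℓ (posterior prior ℓ) →
      (∃ L : ℝ≥0, ∀ lam : ℝ, 0 < lam →
        LipschitzCost Θ ℓ L (marginals (q lam)) (marginals (posterior prior ℓ))) →
      (∃ C : ℝ≥0, TransportInequality Θ C (marginals (posterior prior ℓ))) →
      ∀ qZero : ℝ → Measure (Fin D → ℝ),
        (∀ lam : ℝ, 0 < lam →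
          IsEOTOptimizer Θ ℓ lam (marginals (posterior prior ℓ)) (qZero lam)) →
        Tendsto (fun lam => wasserstein2 (qZero lam) (q lam)) (𝓝[>] 0) (𝓝 0)) := by
  have := hprior
  have hac₁ := posterior_absolutelyContinuous prior ℓ
  have hac₂ := absolutelyContinuous_posterior hZ
  have hprob := isProbabilityMeasure_posterior hZ
  refine ⟨?_, ?_⟩
  · rintro ⟨m, hm, hkl⟩ hass qInf hqInf
    obtain ⟨K, hK, hKF⟩ := exists_xiObjective_le hpost hm hkl
    have hF : ∀ lam : ℝ, 0 < lam → xiObjective (posterior prior ℓ) (ENNReal.ofReal lam) (q lam)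
        ≤ ENNReal.ofReal K := fun lam h => hKF _ _ (hq lam h)
    have hmain : Tendsto (fun lam => ⨅ p ∈ xiPosteriors Θ (posterior prior ℓ) ∞,
        wasserstein2 (qInf p lam) (q lam)) atTop (𝓝 0) := by
      -- the constants in the assumptions depend on the mean-field posterior, so it has to be fixed:
      -- along an ultrafilter there is a single limit
      rw [tendsto_iff_ultrafilter]
      intro U hU
      obtain ⟨p, hp, hpprod, hpac, hpT⟩ :=
        exists_meanField_limit hpost hac₁ hac₂ hq hK hF U hU
      have hpprob : IsProbabilityMeasure p := hp.1.1.1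
      obtain ⟨hℓp, ⟨L, hL⟩, C, hC⟩ := hass p hp
      -- `p` is itself a product measure, so it plays both parts in `integrable_of_integrable_sum`
      have hbint : ∀ φ : Fin D → ℝ → ℝ, (∀ i, Measurable (φ i)) →
          Integrable (fun θ => ℓ θ - ∑ i, φ i (θ i)) p →
          Integrable (fun θ => ℓ θ - ∑ i, φ i (θ i)) (Measure.pi (marginals p)) →
          ∀ i, Integrable (φ i) (marginals p i) := by
        intro φ hφ hg _
        have hsum : Integrable (fun θ : Fin D → ℝ => ∑ i, φ i (θ i)) p :=
          (hℓp.sub hg).congr (ae_of_all _ fun θ => by simp)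
        exact integrable_of_integrable_sum hφ (by rwa [← hpprod]) (ae_of_all _ fun _ => le_rfl)
          rfl hsum
      have hT : Tendsto (fun lam => transportCost (qInf p lam) (q lam)) U (𝓝 0) := by
        refine tendsto_transportCost_of_le_modulus (L := L) (C := C) hpT ?_
        filter_upwards [hU (eventually_gt_atTop 0)] with lam h δ hδ hδtop
        rw [transportCost_comm] at hδ
        exact transportCost_eot_xiPosterior_le hZ hpost h (hq lam h)
          (ne_top_of_le_ne_top ENNReal.ofReal_ne_top (hF lam h)) hpac hbint (hL lam h) hC
          (hqInf p hp lam h) hδ hδtop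
      exact tendsto_of_tendsto_of_tendsto_of_le_of_le tendsto_const_nhds
        (tendsto_wasserstein2_of_transportCost hT) (fun _ => zero_le) fun lam => iInf₂_le p hp
    refine ⟨fun p hp => ?_, hmain⟩
    simpa [hp] using hmain
  · rintro hℓpost ⟨L, hL⟩ ⟨C, hC⟩ qZero hqZero
    have hΞ : expressivity (posterior prior ℓ) ≠ ∞ :=
      ne_top_of_le_ne_top (klDiv_posterior_prior_ne_top hZ hℓpost) (klDiv_pi_marginals_le _ prior)
    obtain ⟨hF, hT⟩ := tendsto_transportCost_posterior hpost hac₁ hac₂ hΞ hq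
    refine tendsto_wasserstein2_of_transportCost
      (tendsto_transportCost_of_le_modulus (L := L) (C := C) hT ?_)
    filter_upwards [self_mem_nhdsWithin] with lam h δ hδ hδtop
    rw [transportCost_comm] at hδ
    exact transportCost_eot_xiPosterior_le hZ hpost h (hq lam h) (hF lam h)
      Measure.AbsolutelyContinuous.rfl
      (fun φ hφ h1 h2 => integrable_of_posterior hZ hℓpost hφ h1 h2)
      (hL lam h) hC (hqZero lam h) hδ hδtop
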